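/- Let $\mathfrak g$ be a finite-dimensional simple complex Lie algebra of simply-laced type, with a Cartan subalgebra, simple roots $\alpha_i$ ($i\in I$), simple reflections $s_i$, positive roots $\Phi_+$ and Cartan matrix $(c_{ij})$. Write $i\sim j$ if $c_{ij}=-1$. Let $Q$ be an orientation of the Dynkin diagram of $\mathfrak g$, and let $\xi:I\to\mathbb Z$ be a height function adapted to $Q$, i.e. $\xi(j)=\xi(i)-1$ whenever there is an arrow $i\to j$ in $Q$. Put $$I^{\le\xi}=\{(i,p)\mid i\in I,\ p\in\xi(i)+2\mathbb Z_{\le 0}\}.$$ For $i\in I$ let $\gamma_i$ be the sum of the $\alpha_j$ over all $j\in I$ such that there is a (possibly trivial) path from $j$ to $i$ in $Q$. Let $\tau_Q=s_{i_1}\cdots s_{i_n}$ be the Coxeter element adapted to $Q$: here $(i_1,\dots,i_n)$ lists every element of $I$ exactly once, $i_1$ is a source of $Q$, and for each $k\ge 2$ the vertex $i_k$ is a source of the quiver obtained from $Q$ by reversing, successively for $l=1,\dots,k-1$, all arrows incident to $i_l$. For $(j,s)\in I^{\le\xi}$ define positive roots $\beta_{j,s}\in\Phi_+$ by $\beta_{j,\xi(j)}=\gamma_j$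 and $\beta_{j,s-2}=\pm\tau_Q(\beta_{j,s})$, with the sign for which this is a positive root. Let $C(z)$ be the quantum Cartan matrix, with entries $C_{ii}(z)=z+z^{-1}$, $C_{ij}(z)=-1$ if $i\sim j$, and $C_{ij}(z)=0$ otherwise. For $m\ge 1$ let $\tilde C_{ij}(m)$ be the coefficient of $z^m$ in the expansion as a power series in $z$ of the $(i,j)$ entry of $C(z)^{-1}$, and put $\tilde C_{ij}(m)=0$ for $m\le 0$. Let $$\widetilde D_\xi:\ \mathbb C[Y_{i,p}^{\pm1},\ (i,p)\in I^{\le\xi}]\longrightarrow\mathbb C(\alpha_i,\ i\in I)$$ be the algebra morphism given by $$\widetilde D_\xi(Y_{i,p})=\prod_{(j,s)\in I^{\le\xi}}\beta_{j,s}^{\ \tilde C_{ij}(s-p-1)-\tilde C_{ij}(s-p+1)}$$ (a product with finitely many factors different from $1$). For a positive root $\beta$ and a nonzero rational fraction $f\in\mathbb C(\alpha_i,\ i\in I)$, let $[\beta;f]\in\mathbb Z$ be the multiplicity of the linear form $\beta$ in $f$ (its multiplicity in the numerator minus its multiplicity in the denominator). Then for every $(i,p)\in I^{\le\xi}$ and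 every $\beta\in\Phi_+$ one has $$\bigl|\,[\beta;\widetilde D_\xi(Y_{i,p})]\,\bigr|\le 1 .$$ -/

import Mathlib

noncomputable section

open scoped Classical

namespace DynkinQuiver

/-! ### Orientations, height functions and adapted sequences -/

section Quiver

variable {V : Type*}

/-- `i` is a source of `Q`: no arrow ends at `i`. -/
def IsSource (Q : Digraph V) (i : V) : Prop :=
  ∀ j, ¬ Q.Adj j i

/-- The quiver `s_i(Q)`: every arrow with source `i` or target `i` is reversed. -/
def reflectAt (Q : Digraph V) (i : V) : Digraph V where
  Adj j k := if j = i ∨ k = i then Q.Adj k j else Q.Adj j k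

/-- The sequence `(i₁, …, i_k)` is adapted to `Q`: `i₁` is a source of `Q`, `i₂` is a source of
`s_{i₁}(Q)`, and so on. -/
def IsAdapted : Digraph V → List V → Prop
  | _, [] => True
  | Q, i :: l => IsSource Q i ∧ IsAdapted (reflectAt Q i) l

/-- A sequence adapted to `Q` in which every vertex occurs exactly once. -/
def IsCoxeterWord (Q : Digraph V) (l : List V) : Prop :=
  l.Nodup ∧ (∀ i, i ∈ l) ∧ IsAdapted Q l

/-- A height function adapted to `Q`: `ξ j = ξ i - 1` for every arrow `i → j`. -/
def IsHeightFunction (Q : Digraph V) (ξ : V → ℤ) : Prop :=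
  ∀ i j, Q.Adj i j → ξ j = ξ i - 1

theorem isAdapted_of_pairwise (ξ : V → ℤ) (l : List V) :
    ∀ Q : Digraph V, l.Nodup → l.Pairwise (fun a b => ξ b ≤ ξ a) →
      (∀ j, ∀ i ∈ l, Q.Adj j i → j ∈ l ∧ ξ i < ξ j) → IsAdapted Q l := by
  induction l with
  | nil => intro Q _ _ _; trivial
  | cons i l ih =>
    intro Q hn hp hQ
    rw [List.nodup_cons] at hn
    rw [List.pairwise_cons] at hp
    refine ⟨?_, ih _ hn.2 hp.2 ?_⟩
    · intro j hj
      obtain ⟨h1, h2⟩ := hQ j i (by simp) hj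
      rcases List.mem_cons.1 h1 with rfl | h1
      · exact lt_irrefl _ h2
      · exact absurd (hp.1 j h1) (not_le.2 h2)
    · intro j k hk hjk
      have hki : k ≠ i := fun h => hn.1 (h ▸ hk)
      by_cases hji : j = i
      · subst hji
        have h : Q.Adj k j := by simpa [reflectAt] using hjk
        exact absurd (hp.1 k hk) (not_le.2 (hQ k j (by simp) h).2)
      · have h : Q.Adj j k := by simpa [reflectAt, hji, hki] using hjk
        obtain ⟨h1, h2⟩ := hQ j k (by simp [hk]) h
        rcases List.mem_cons.1 h1 with h1 | h1
        · exact absurd h1 hji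
        · exact ⟨h1, h2⟩

theorem exists_isCoxeterWord [Fintype V] (Q : Digraph V) (ξ : V → ℤ)
    (hξ : IsHeightFunction Q ξ) : ∃ l, IsCoxeterWord Q l := by
  let le : V → V → Bool := fun a b => decide (ξ b ≤ ξ a)
  let l := (Finset.univ : Finset V).toList.mergeSort le
  have hperm : l.Perm (Finset.univ : Finset V).toList := List.mergeSort_perm _ _
  have hmem : ∀ i, i ∈ l := fun i => hperm.mem_iff.2 (by simp)
  have hnd : l.Nodup := hperm.nodup_iff.2 (Finset.nodup_toList _)
  refine ⟨l, hnd, hmem, isAdapted_of_pairwise ξ l Q hnd ?_ ?_⟩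
  · have h := List.pairwise_mergeSort (le := le)
      (fun a b c h1 h2 => by simp only [le, decide_eq_true_eq] at *; omega)
      (fun a b => by simp only [le, Bool.or_eq_true, decide_eq_true_eq]; omega)
      (Finset.univ : Finset V).toList
    exact h.imp (fun h => by simpa [le] using h)
  · intro j i _ hji
    refine ⟨hmem j, ?_⟩
    have := hξ j i hji
    omega

/-- A chosen sequence adapted to `Q` in which every vertex occurs exactly once. -/
def coxeterWord (Q : Digraph V) : List V :=
  Classical.epsilon (IsCoxeterWord Q)

theorem coxeterWord_spec [Fintype V] (Q : Digraph V) (ξ : V → ℤ)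
    (hξ : IsHeightFunction Q ξ) : IsCoxeterWord Q (coxeterWord Q) :=
  Classical.epsilon_spec (exists_isCoxeterWord Q ξ hξ)

/-- The set `I^{≤ξ}` of the pairs `(i, p)` with `p ∈ ξ(i) + 2ℤ_{≤0}`. -/
abbrev Below (ξ : V → ℤ) : Type _ :=
  {x : V × ℤ // ∃ k : ℕ, x.2 = ξ x.1 - 2 * (k : ℤ)}

end Quiver

/-! ### The inverse of the quantum Cartan matrix -/

section QuantumCartan

variable {V : Type*} [Fintype V]

/-- The quantum Cartan matrix `C(z)` of a simply-laced Cartan matrix `C`, with entries in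
`ℤ((z))`: `z + z⁻¹` on the diagonal, `-1` where `c_{ij} = -1`, and `0` elsewhere. -/
def quantumCartan (C : Matrix V V ℤ) : Matrix V V (LaurentSeries ℤ) :=
  Matrix.of fun i j =>
    if i = j then HahnSeries.single 1 1 + HahnSeries.single (-1) 1
    else if C i j = -1 then -1 else 0

/-- The coefficient `C̃_{ij}(m)` of `z ^ m` in the power series expansion of the `(i, j)` entry of
`C(z)⁻¹` for `m ≥ 1`, extended by `0` to `m ≤ 0`. -/
def cTilde (C : Matrix V V ℤ) (i j : V) (m : ℤ) : ℤ :=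
  if 1 ≤ m then ((quantumCartan C)⁻¹ i j).coeff m else 0

theorem isUnit_det_quantumCartan (C : Matrix V V ℤ) : IsUnit (quantumCartan C).det := by
  let B : Matrix V V (PowerSeries ℤ) := Matrix.of fun i j =>
    if i = j then 1 + PowerSeries.X ^ 2 else if C i j = -1 then -PowerSeries.X else 0
  have hB : IsUnit B.det := by
    rw [PowerSeries.isUnit_iff_constantCoeff, RingHom.map_det]
    have : (PowerSeries.constantCoeff (R := ℤ)).mapMatrix B = 1 := by
      ext i j
      by_cases h : i = j
      · subst h
        simp [B]
      · by_cases h' : C i j = -1 <;> simp [B, h, h']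
    rw [this]
    simp
  have hz : IsUnit (HahnSeries.single (-1 : ℤ) (1 : ℤ)) :=
    IsUnit.of_mul_eq_one (HahnSeries.single (1 : ℤ) (1 : ℤ)) (by simp)
  have h : quantumCartan C =
      (HahnSeries.single (-1 : ℤ) (1 : ℤ)) • (HahnSeries.ofPowerSeries ℤ ℤ).mapMatrix B := by
    ext1 i j
    by_cases h : i = j
    · simp [quantumCartan, B, h, mul_add, HahnSeries.ofPowerSeries_X_pow, add_comm]
    · by_cases h' : C i j = -1 <;>
        simp [quantumCartan, B, h, h', HahnSeries.ofPowerSeries_X]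
  rw [h, Matrix.det_smul, ← RingHom.map_det]
  exact (hz.pow _).mul (hB.map _)

end QuantumCartan

/-! ### The roots `β_{j,s}` and the morphism `D̃_ξ` -/

section RootSystem

variable {ι M N : Type*} [AddCommGroup M] [Module ℂ M] [AddCommGroup N] [Module ℂ N]
  {P : RootPairing ι ℂ M N} (b : P.Base)

/-- `Q` is an orientation of the Dynkin diagram: the underlying graph of `Q` has an edge between
`i` and `j` exactly when `c_{ij} = -1`, and every edge carries exactly one direction. -/
structure IsOrientation [P.IsCrystallographic] (Q : Digraph b.support) : Prop where
  adj_or_adj_iff : ∀ i j, (Q.Adj i j ∨ Q.Adj j i) ↔ b.cartanMatrix i j = -1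
  asymm : ∀ i j, Q.Adj i j → ¬ Q.Adj j i

/-- The Coxeter element `τ_Q = s_{i₁} ⋯ s_{i_n}`, where `(i₁, …, i_n)` is a sequence adapted to
`Q` in which every vertex occurs exactly once. -/
def coxeterElement (Q : Digraph b.support) : M ≃ₗ[ℂ] M :=
  ((coxeterWord Q).map fun i => P.reflection i).prod

/-- `γ_i`, the sum of the simple roots `α_j` over all `j` such that `Q` has a path from `j` to `i`
(the path of length zero included). -/
def gammaRoot (Q : Digraph b.support) (i : b.support) : M :=
  ∑ j ∈ Finset.univ.filter (fun j : b.support => Relation.ReflTransGen Q.Adj j i), P.root j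

/-- The vector `v` is a positive root. -/
def IsPosRoot (v : M) : Prop :=
  ∃ k, b.IsPos k ∧ P.root k = v

/-- `betaSeq b Q j m` is `β_{j, ξ(j) - 2m}`, given by `β_{j, ξ(j)} = γ_j` and
`β_{j, s-2} = ± τ_Q (β_{j,s})`, with the sign that makes it a positive root. -/
def betaSeq (Q : Digraph b.support) (j : b.support) : ℕ → M
  | 0 => gammaRoot b Q j
  | m + 1 =>
    if IsPosRoot b (coxeterElement b Q (betaSeq Q j m)) then coxeterElement b Q (betaSeq Q j m)
    else -coxeterElement b Q (betaSeq Q j m)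

/-- The positive root `β_{j,s}` for `(j, s) ∈ I^{≤ξ}`. -/
def beta (Q : Digraph b.support) {ξ : b.support → ℤ} (x : Below ξ) : M :=
  betaSeq b Q x.1.1 ((ξ x.1.1 - x.1.2) / 2).toNat

variable [P.IsRootSystem]

/-- The polynomial ring `ℂ[α_i, i ∈ I]`. -/
abbrev RootPoly : Type _ := MvPolynomial b.support ℂ

/-- The field `ℂ(α_i, i ∈ I)`. -/
abbrev RootField : Type _ := FractionRing (RootPoly b)

/-- A vector `∑ c_i α_i` regarded as the linear form `∑ c_i α_i` in `ℂ[α_i, i ∈ I]`. -/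
def linForm (v : M) : RootPoly b :=
  ∑ i, MvPolynomial.C (b.toWeightBasis.repr v i) * MvPolynomial.X i

/-- The multiplicity `[β; f]` of `β` in the rational fraction `f ≠ 0`: the multiplicity of the
linear form `β` in the numerator of `f` minus its multiplicity in the denominator. -/
def rootMult (v : M) (f : RootField b) : ℤ :=
  (multiplicity (linForm b v) (IsFractionRing.num (RootPoly b) f) : ℤ) -
    (multiplicity (linForm b v) (IsFractionRing.den (RootPoly b) f : RootPoly b) : ℤ)

theorem linForm_ne_zero {v : M} (hv : v ≠ 0) : linForm b v ≠ 0 := by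
  intro h
  apply hv
  apply b.toWeightBasis.repr.injective
  ext i
  have h' := congrArg (MvPolynomial.coeff (Finsupp.single i 1)) h
  simpa [linForm, MvPolynomial.coeff_sum, MvPolynomial.coeff_C_mul, MvPolynomial.coeff_X,
    Finsupp.single_left_inj] using h'

theorem gammaRoot_ne_zero (Q : Digraph b.support) (i : b.support) : gammaRoot b Q i ≠ 0 := by
  intro h
  have h' := congrArg (fun v => b.toWeightBasis.repr v i) h
  simp [gammaRoot, Finsupp.single_apply, Finset.sum_ite_eq', Relation.ReflTransGen.refl] at h'

theorem beta_ne_zero (Q : Digraph b.support) {ξ : b.support → ℤ} (x : Below ξ) :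
    beta b Q x ≠ 0 := by
  have key : ∀ j m, betaSeq b Q j m ≠ 0 := by
    intro j m
    induction m with
    | zero => exact gammaRoot_ne_zero b Q j
    | succ m ih =>
      rw [betaSeq]
      split_ifs
      · simpa using ih
      · simpa using ih
  exact key _ _

/-- The element `β_{j,s}` of the multiplicative group of `ℂ(α_i, i ∈ I)`. -/
def betaUnit (Q : Digraph b.support) {ξ : b.support → ℤ} (x : Below ξ) : (RootField b)ˣ :=
  Units.mk0 (algebraMap (RootPoly b) (RootField b) (linForm b (beta b Q x))) (by
    rw [Ne, map_eq_zero_iff _ (IsFractionRing.injective (RootPoly b) (RootField b))]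
    exact linForm_ne_zero b (beta_ne_zero b Q x))

variable [P.IsCrystallographic]

/-- The product of the `β_{j,s} ^ (C̃_{ij}(s - p - 1) - C̃_{ij}(s - p + 1))` over all
`(j, s) ∈ I^{≤ξ}`, for `x = (i, p)`; almost all of its factors are `1`. -/
def dTildeValue (Q : Digraph b.support) (ξ : b.support → ℤ) (x : Below ξ) : (RootField b)ˣ :=
  ∏ᶠ y : Below ξ, betaUnit b Q y ^
    (cTilde b.cartanMatrix x.1.1 y.1.1 (y.1.2 - x.1.2 - 1) -
      cTilde b.cartanMatrix x.1.1 y.1.1 (y.1.2 - x.1.2 + 1))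

theorem finite_mulSupport_dTildeValue (Q : Digraph b.support) (ξ : b.support → ℤ)
    (x : Below ξ) :
    (Function.mulSupport fun y : Below ξ => betaUnit b Q y ^
      (cTilde b.cartanMatrix x.1.1 y.1.1 (y.1.2 - x.1.2 - 1) -
        cTilde b.cartanMatrix x.1.1 y.1.1 (y.1.2 - x.1.2 + 1))).Finite := by
  have hfin : (⋃ j : b.support, (fun s : ℤ => (j, s)) '' Set.Icc x.1.2 (ξ j)).Finite :=
    Set.finite_iUnion fun j => (Set.finite_Icc _ _).image _
  refine (hfin.preimage (f := Subtype.val) Subtype.val_injective.injOn).subset ?_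
  rintro ⟨⟨j, s⟩, k, hk⟩ hy
  simp only at hk
  simp only [Set.mem_preimage, Set.mem_iUnion]
  refine ⟨j, s, ⟨?_, by omega⟩, rfl⟩
  by_contra hlt
  apply hy
  have h1 : ¬ (1 ≤ s - x.1.2 - 1) := by omega
  have h2 : ¬ (1 ≤ s - x.1.2 + 1) := by omega
  simp [cTilde, h1, h2]

/-- The complexified torus `ℂ ⊗ 𝒴^{≤ξ} = ℂ[Y_{i,p}^{±1}, (i,p) ∈ I^{≤ξ}]`, the group algebra of
the free abelian group on `I^{≤ξ}`. -/
abbrev YTorus {V : Type*} (ξ : V → ℤ) : Type _ := AddMonoidAlgebra ℂ (Below ξ →₀ ℤ)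

/-- The variable `Y_{i,p}`. -/
def yVar {V : Type*} {ξ : V → ℤ} (x : Below ξ) : YTorus ξ :=
  AddMonoidAlgebra.single (Finsupp.single x 1) 1

/-- The algebra morphism `D̃_ξ : ℂ ⊗ 𝒴^{≤ξ} → ℂ(α_i, i ∈ I)`. -/
def dTilde (Q : Digraph b.support) (ξ : b.support → ℤ) : YTorus ξ →ₐ[ℂ] RootField b :=
  AddMonoidAlgebra.lift ℂ (RootField b) (Below ξ →₀ ℤ)
    ((Units.coeHom (RootField b)).comp
      (AddMonoidHom.toMultiplicativeLeft (Finsupp.liftAddHom fun x : Below ξ =>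
        (zmultiplesHom (Additive (RootField b)ˣ) (Additive.ofMul (dTildeValue b Q ξ x))))))

theorem dTilde_yVar (Q : Digraph b.support) (ξ : b.support → ℤ) (x : Below ξ) :
    dTilde b Q ξ (yVar x) = (dTildeValue b Q ξ x : RootField b) := by
  simp [dTilde, yVar]

end RootSystem

end DynkinQuiver

end

/-!
Write the roots in the basis of simple roots. Multiplying out an adapted word gives
`τ_Q v = v - ∑ j, (v, α_j) γ_j`, so the signed roots `τ_Q ^ m γ_k`, placed at `(k, ξ k - 2 m)`,
satisfy the mesh relations of the repetition quiver. The form `(r_{i,p}, r_{j,s})` therefore obeys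
in `s` the recurrence that defines `C̃_{ij}`, and the exponent of `β_{j,s}` in `D̃_ξ(Y_{i,p})` is
`-(r_{i,p}, r_{j,s})`, except for an additional `1` at `(j, s) = (i, p)`.

A root `β > 0` thus has multiplicity `-(r_{i,p}, β) N + [r_{i,p} = ± β]`, where `N` counts with
signs the `(j, s)` with `s ≥ p` and `r_{j,s} = ± β`. The `r_{j,s}` with `s ≥ p` are up to sign the
inversions of a Weyl group element, the product of an initial segment of the adapted sequence of
reflections, so `N` is `0` or `1`. Finally `|(r_{i,p}, β)| ≤ 1` unless `r_{i,p} = ± β`; in that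
case `N = 1` for the sign `+`, giving `-2 + 1`, and `N = 0` for the sign `-`, giving `1`.
-/

namespace DynkinQuiver

noncomputable section

open scoped Classical

section Lattice

variable {V : Type*}

/-- The simple root `α_i`, as a basis vector of the root lattice `V → ℤ`. -/
def simple (i : V) : V → ℤ := Pi.single i 1

theorem simple_apply (i j : V) : simple i j = if j = i then 1 else 0 := by
  simp [simple, Pi.single_apply]

theorem not_simple_nonpos (i : V) : ¬ simple i ≤ 0 := fun h => by
  simpa [simple_apply] using h i

theorem simple_ne_neg_simple (i : V) : simple i ≠ -simple i := fun h => by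
  simpa [simple_apply] using congrFun h i

/-- The indicator of the non-positive vectors. For a root `β` and a Weyl group element `w` it tells
whether `β` is an inversion of `w⁻¹`: this is the case when `negInd (w⁻¹ β) - negInd β = 1`. -/
def negInd (v : V → ℤ) : ℤ := if v ≤ 0 then 1 else 0

theorem negInd_simple (i : V) : negInd (simple i) = 0 := if_neg (not_simple_nonpos i)

theorem negInd_neg_simple (i : V) : negInd (-simple i) = 1 :=
  if_pos <| neg_nonpos.2 <| Pi.single_nonneg.2 zero_le_one

/-- The sign with which `u` is equal to `v`: `1` if `v = u ≠ 0`, `-1` if `v = -u ≠ 0`, and `0`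
otherwise. -/
def relSign (u v : V → ℤ) : ℤ := (if v = u then 1 else 0) - (if v = -u then 1 else 0)

theorem relSign_zero_left (v : V → ℤ) : relSign 0 v = 0 := by simp [relSign]

theorem relSign_map (e : (V → ℤ) ≃ₗ[ℤ] (V → ℤ)) (u v : V → ℤ) :
    relSign (e u) (e v) = relSign u v := by
  simp only [relSign, ← map_neg, e.injective.eq_iff]

variable {C : Matrix V V ℤ}

/-- `C` is a positive definite simply-laced Cartan matrix, i.e. of type `ADE` up to direct sums. -/
structure IsPosSimplyLaced (C : Matrix V V ℤ) : Prop where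
  diag : ∀ i, C i i = 2
  simplyLaced : C.IsSimplyLaced
  posDef : C.PosDef

theorem IsPosSimplyLaced.symm (hC : IsPosSimplyLaced C) (i j : V) : C i j = C j i :=
  hC.posDef.isHermitian.apply j i

variable [Fintype V]

theorem sum_smul_simple (x : V → ℤ) : ∑ i, x i • simple i = x := by
  ext j
  simp [simple_apply]

/-- The bilinear form of the root lattice with Gram matrix `C`. -/
def latticeForm (C : Matrix V V ℤ) : LinearMap.BilinForm ℤ (V → ℤ) :=
  Matrix.toBilin' C

theorem latticeForm_apply (C : Matrix V V ℤ) (x y : V → ℤ) :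
    latticeForm C x y = ∑ i, ∑ j, x i * C i j * y j :=
  Matrix.toBilin'_apply C x y

theorem latticeForm_simple (C : Matrix V V ℤ) (i j : V) :
    latticeForm C (simple i) (simple j) = C i j :=
  Matrix.toBilin'_single C i j

theorem eq_or_eq_neg_of_smul_eq_smul {v w : V → ℤ} (hv : latticeForm C v v = 2)
    (hw : latticeForm C w w = 2) {m n : ℤ} (hm : m ≠ 0) (h : m • v = n • w) :
    v = w ∨ v = -w := by
  have hsq : m * m = n * n := by
    have := congrArg (fun u => latticeForm C u u) h
    simp only [map_smul, LinearMap.smul_apply, hv, hw, smul_eq_mul] at this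
    linarith
  rcases mul_self_eq_mul_self_iff.1 hsq with rfl | rfl
  · exact .inl (smul_right_injective _ hm h)
  · exact .inr (smul_right_injective _ hm (by simpa using h))

namespace IsPosSimplyLaced

theorem form_comm (hC : IsPosSimplyLaced C) (x y : V → ℤ) :
    latticeForm C x y = latticeForm C y x := by
  rw [latticeForm_apply, latticeForm_apply, Finset.sum_comm]
  refine Finset.sum_congr rfl fun i _ => Finset.sum_congr rfl fun j _ => ?_
  rw [hC.symm]
  ring

theorem form_self_pos (hC : IsPosSimplyLaced C) {x : V → ℤ} (hx : x ≠ 0) :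
    0 < latticeForm C x x := by
  rw [latticeForm, Matrix.toBilin'_apply']
  exact hC.posDef.dotProduct_mulVec_pos hx

theorem form_add_self (hC : IsPosSimplyLaced C) (x y : V → ℤ) :
    latticeForm C (x + y) (x + y) =
      latticeForm C x x + 2 * latticeForm C x y + latticeForm C y y := by
  simp only [map_add, LinearMap.add_apply, hC.form_comm y x]
  ring

theorem form_sub_self (hC : IsPosSimplyLaced C) (x y : V → ℤ) :
    latticeForm C (x - y) (x - y) =
      latticeForm C x x - 2 * latticeForm C x y + latticeForm C y y := by
  simp only [map_sub, LinearMap.sub_apply, hC.form_comm y x]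
  ring

theorem even_form_self (hC : IsPosSimplyLaced C) (x : V → ℤ) : Even (latticeForm C x x) := by
  rw [← sum_smul_simple x]
  induction (Finset.univ : Finset V) using Finset.induction_on with
  | empty => simp
  | insert i s hi ih =>
    rw [Finset.sum_insert hi, hC.form_add_self]
    refine (Even.add ?_ (even_two_mul _)).add ih
    simp only [map_smul, LinearMap.smul_apply, latticeForm_simple, hC.diag, smul_eq_mul]
    exact (even_two.mul_left _).mul_left _

theorem form_posPart_negPart_nonpos (hC : IsPosSimplyLaced C) (v : V → ℤ) :
    latticeForm C v⁺ v⁻ ≤ 0 := by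
  rw [latticeForm_apply]
  refine Finset.sum_nonpos fun i _ => Finset.sum_nonpos fun j _ => ?_
  have hi : 0 ≤ v⁺ i := posPart_nonneg v i
  have hj : 0 ≤ v⁻ j := negPart_nonneg v j
  obtain rfl | hij := eq_or_ne i j
  · have disjoint : v⁺ i = 0 ∨ v⁻ i = 0 := by
      rw [Pi.posPart_apply, Pi.negPart_apply, posPart_eq_zero, negPart_eq_zero]
      exact le_total _ _
    rcases disjoint with h | h <;> simp [h]
  · rcases hC.simplyLaced hij with h | h <;> rw [h]
    · simp
    · nlinarith

theorem nonneg_or_nonpos (hC : IsPosSimplyLaced C) {v : V → ℤ} (hv : latticeForm C v v = 2) :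
    0 ≤ v ∨ v ≤ 0 := by
  by_contra! hcon
  have hp := hC.form_self_pos fun h => hcon.2 (posPart_eq_zero.1 h)
  have hn := hC.form_self_pos fun h => hcon.1 (negPart_eq_zero.1 h)
  obtain ⟨m, hm⟩ := hC.even_form_self v⁺
  obtain ⟨n, hn'⟩ := hC.even_form_self v⁻
  have hmix := hC.form_posPart_negPart_nonpos v
  have hsplit := hC.form_sub_self v⁺ v⁻
  rw [posPart_sub_negPart] at hsplit
  omega

theorem form_le_one (hC : IsPosSimplyLaced C) {v w : V → ℤ} (hv : latticeForm C v v = 2)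
    (hw : latticeForm C w w = 2) (h : v ≠ w) : latticeForm C v w ≤ 1 := by
  have := hC.form_self_pos (sub_ne_zero.2 h)
  rw [hC.form_sub_self] at this
  omega

theorem neg_one_le_form (hC : IsPosSimplyLaced C) {v w : V → ℤ} (hv : latticeForm C v v = 2)
    (hw : latticeForm C w w = 2) (h : v ≠ -w) : -1 ≤ latticeForm C v w := by
  have := hC.form_le_one hv (w := -w) (by simpa using hw) h
  rw [map_neg] at this
  omega

theorem flip_form_simple_self (hC : IsPosSimplyLaced C) (i : V) :
    (latticeForm C).flip (simple i) (simple i) = 2 := by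
  rw [LinearMap.BilinForm.flip_apply, latticeForm_simple, hC.diag]

/-- The simple reflection `v ↦ v - (v, α_i) α_i` of the root lattice. -/
def refl (hC : IsPosSimplyLaced C) (i : V) : (V → ℤ) ≃ₗ[ℤ] (V → ℤ) :=
  Module.reflection (hC.flip_form_simple_self i)

theorem refl_apply (hC : IsPosSimplyLaced C) (i : V) (v : V → ℤ) :
    hC.refl i v = v - latticeForm C v (simple i) • simple i := by
  rw [refl, Module.reflection_apply, LinearMap.BilinForm.flip_apply]

theorem refl_symm (hC : IsPosSimplyLaced C) (i : V) : (hC.refl i).symm = hC.refl i :=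
  Module.reflection_symm _

theorem refl_simple_self (hC : IsPosSimplyLaced C) (i : V) :
    hC.refl i (simple i) = -simple i := by
  rw [refl_apply, latticeForm_simple, hC.diag]
  module

theorem form_refl (hC : IsPosSimplyLaced C) (i : V) (v w : V → ℤ) :
    latticeForm C (hC.refl i v) (hC.refl i w) = latticeForm C v w := by
  simp only [refl_apply, map_sub, LinearMap.sub_apply, map_smul, LinearMap.smul_apply,
    latticeForm_simple, hC.diag, smul_eq_mul, hC.form_comm (simple i) w]
  ring

theorem exists_ne_apply_ne_zero (hC : IsPosSimplyLaced C) {v : V → ℤ}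
    (hv : latticeForm C v v = 2) {i : V} (hi : v ≠ simple i) (hi' : v ≠ -simple i) :
    ∃ k ≠ i, v k ≠ 0 := by
  by_contra! hcon
  have hvi : (1 : ℤ) • v = v i • simple i := by
    ext k
    obtain rfl | hk := eq_or_ne k i
    · simp [simple_apply]
    · simp [simple_apply, hk, hcon k hk]
  have hs : latticeForm C (simple i) (simple i) = 2 := by rw [latticeForm_simple, hC.diag]
  exact (eq_or_eq_neg_of_smul_eq_smul hv hs one_ne_zero hvi).elim hi hi'

theorem negInd_eq_of_apply_ne_zero (hC : IsPosSimplyLaced C) {v : V → ℤ}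
    (hv : latticeForm C v v = 2) {k : V} (hk : v k ≠ 0) :
    negInd v = if v k < 0 then 1 else 0 := by
  refine if_congr ⟨fun h => lt_of_le_of_ne (h k) hk, fun h => ?_⟩ rfl rfl
  exact (hC.nonneg_or_nonpos hv).resolve_left fun h' => (h' k).not_gt h

theorem negInd_refl (hC : IsPosSimplyLaced C) (i : V) {v : V → ℤ}
    (hv : latticeForm C v v = 2) :
    negInd (hC.refl i v) = negInd v + relSign (simple i) v := by
  have hne := simple_ne_neg_simple i
  by_cases hi : v = simple i
  · simp [hi, relSign, refl_simple_self, negInd_simple, negInd_neg_simple, hne]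
  by_cases hi' : v = -simple i
  · simp [hi', relSign, refl_simple_self, negInd_simple, negInd_neg_simple, hne.symm]
  obtain ⟨k, hki, hk⟩ := hC.exists_ne_apply_ne_zero hv hi hi'
  have hk' : hC.refl i v k = v k := by simp [refl_apply, simple_apply, hki]
  rw [hC.negInd_eq_of_apply_ne_zero hv hk,
    hC.negInd_eq_of_apply_ne_zero ((hC.form_refl i v v).trans hv) (hk'.trans_ne hk), hk']
  simp [relSign, hi, hi']

theorem exists_prod_refl_of_orthogonal (hC : IsPosSimplyLaced C) (J : Finset V)
    (hJ : (J : Set V).Pairwise fun i j => C i j = 0) :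
    ∃ R : (V → ℤ) ≃ₗ[ℤ] (V → ℤ),
      (∀ v w, latticeForm C (R v) (R w) = latticeForm C v w) ∧
      (∀ v, R v = v - ∑ j ∈ J, latticeForm C v (simple j) • simple j) ∧
      ∀ v, latticeForm C v v = 2 →
        negInd (R.symm v) = negInd v + ∑ j ∈ J, relSign (simple j) v := by
  induction J using Finset.induction_on with
  | empty => exact ⟨LinearEquiv.refl _ _, by simp, by simp, by simp⟩
  | insert i s hi ih =>
    obtain ⟨R, hR, hRv, hneg⟩ := ih (hJ.mono (Finset.coe_subset.2 (Finset.subset_insert i s)))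
    have hRi : R (simple i) = simple i := by
      rw [hRv, Finset.sum_eq_zero, sub_zero]
      intro j hj
      rw [latticeForm_simple, hJ (by simp) (by simp [hj]) (ne_of_mem_of_not_mem hj hi).symm,
        zero_smul]
    refine ⟨(hC.refl i).trans R, fun v w => ?_, fun v => ?_, fun v hv => ?_⟩
    · simp only [LinearEquiv.trans_apply, hR, form_refl]
    · rw [LinearEquiv.trans_apply, hC.refl_apply, map_sub, map_smul, hRi, hRv,
        Finset.sum_insert hi]
      abel
    · have hu : latticeForm C (R.symm v) (R.symm v) = 2 := by
        rw [← hR, R.apply_symm_apply, hv]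
      have hsign : relSign (simple i) (R.symm v) = relSign (simple i) v := by
        rw [← relSign_map R, hRi, R.apply_symm_apply]
      rw [LinearEquiv.trans_symm, LinearEquiv.trans_apply, refl_symm, hC.negInd_refl i hu, hsign,
        hneg v hv, Finset.sum_insert hi]
      ring

end IsPosSimplyLaced

end Lattice

section Quiver

variable {V : Type*} {C : Matrix V V ℤ} {Q : Digraph V} {ξ : V → ℤ}

/-- `Q` is an orientation of the graph with an edge `i - j` for every entry `C i j = -1`: this is
`IsOrientation` for a matrix that need not come from a root pairing. -/
structure IsOrientationOf (Q : Digraph V) (C : Matrix V V ℤ) : Prop where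
  adj_or_adj_iff : ∀ i j, (Q.Adj i j ∨ Q.Adj j i) ↔ C i j = -1
  asymm : ∀ i j, Q.Adj i j → ¬ Q.Adj j i

theorem IsOrientationOf.ne_of_adj (hQ : IsOrientationOf Q C) {i j : V} (h : Q.Adj i j) : i ≠ j := by
  rintro rfl
  exact hQ.asymm _ _ h h

theorem IsOrientationOf.entry_eq (hC : IsPosSimplyLaced C) (hQ : IsOrientationOf Q C) (i j : V) :
    C i j = 2 * (if i = j then 1 else 0) - (if Q.Adj i j then 1 else 0)
      - (if Q.Adj j i then 1 else 0) := by
  have hadj := hQ.adj_or_adj_iff i j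
  have hasymm := hQ.asymm i j
  obtain rfl | hij := eq_or_ne i j
  · have hloop : ¬ Q.Adj i i := fun h => hasymm h h
    simp [hC.diag, hloop]
  · rcases hC.simplyLaced hij with h | h <;> rw [h] at hadj ⊢ <;> grind

theorem IsHeightFunction.eq_or_lt (hξ : IsHeightFunction Q ξ) {a b : V}
    (h : Relation.ReflTransGen Q.Adj a b) : a = b ∨ ξ b < ξ a := by
  induction h with
  | refl => exact .inl rfl
  | tail _ h ih =>
    have := hξ _ _ h
    rcases ih with rfl | ih <;> right <;> omega

theorem IsHeightFunction.not_reflTransGen_of_adj (hξ : IsHeightFunction Q ξ) {i k : V}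
    (h : Q.Adj i k) : ¬ Relation.ReflTransGen Q.Adj k i := fun hki => by
  have := hξ _ _ h
  rcases hξ.eq_or_lt hki with rfl | _ <;> omega

theorem IsAdapted.pairwise_not_adj {l : List V} (hl : l.Nodup) (h : IsAdapted Q l) :
    l.Pairwise fun a b => ¬ Q.Adj b a := by
  induction l generalizing Q with
  | nil => exact .nil
  | cons i l ih =>
    obtain ⟨hil, hl⟩ := List.nodup_cons.1 hl
    refine List.pairwise_cons.2 ⟨fun b _ => h.1 b, (ih hl h.2).imp_of_mem ?_⟩
    intro a b ha hb hab
    simpa [reflectAt, ne_of_mem_of_not_mem ha hil, ne_of_mem_of_not_mem hb hil] using hab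

/-- Positivity of the form on the indicator vector of `A` says that the graph induced on `A` has
fewer edges than vertices. -/
theorem IsOrientationOf.sum_card_adj_lt [Finite V] (hC : IsPosSimplyLaced C)
    (hQ : IsOrientationOf Q C) {A : Finset V} (hA : A.Nonempty) :
    ∑ c ∈ A, (A.filter (Q.Adj c)).card < A.card := by
  cases nonempty_fintype V
  obtain ⟨a, ha⟩ := hA
  have hne : ∑ i ∈ A, simple i ≠ (0 : V → ℤ) := fun h => by
    simpa [simple_apply, ha] using congrFun h a
  have hout : ∑ c ∈ A, ∑ d ∈ A, (if Q.Adj c d then 1 else 0 : ℤ) =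
      ∑ c ∈ A, ((A.filter (Q.Adj c)).card : ℤ) := by simp
  have hform : latticeForm C (∑ i ∈ A, simple i) (∑ i ∈ A, simple i) =
      2 * A.card - 2 * ∑ c ∈ A, ((A.filter (Q.Adj c)).card : ℤ) :=
    calc latticeForm C (∑ i ∈ A, simple i) (∑ i ∈ A, simple i)
        = ∑ c ∈ A, ∑ d ∈ A, C c d := by
          simp only [map_sum, LinearMap.sum_apply, latticeForm_simple]
          exact Finset.sum_comm
      _ = ∑ c ∈ A, ∑ d ∈ A, (2 * (if c = d then 1 else 0) - (if Q.Adj c d then 1 else 0)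
            - (if Q.Adj d c then 1 else 0)) := by
          simp only [hQ.entry_eq hC]
      _ = 2 * A.card - ∑ c ∈ A, ∑ d ∈ A, (if Q.Adj c d then 1 else 0)
            - ∑ c ∈ A, ∑ d ∈ A, (if Q.Adj d c then 1 else 0) := by
          simp [Finset.sum_sub_distrib, mul_comm]
      _ = _ := by
          rw [Finset.sum_comm (f := fun c d => if Q.Adj d c then (1 : ℤ) else 0), hout]
          ring
  have hpos := hC.form_self_pos hne
  zify
  linarith

theorem IsOrientationOf.succ_unique [Finite V] (hC : IsPosSimplyLaced C)
    (hQ : IsOrientationOf Q C) {k a b₁ b₂ : V} (h₁ : Q.Adj a b₁) (h₂ : Q.Adj a b₂)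
    (hk₁ : Relation.ReflTransGen Q.Adj b₁ k) (hk₂ : Relation.ReflTransGen Q.Adj b₂ k) :
    b₁ = b₂ := by
  cases nonempty_fintype V
  by_contra hne
  set A : Finset V := {j | Relation.ReflTransGen Q.Adj j k} with hA
  have hmem : ∀ {j}, j ∈ A ↔ Relation.ReflTransGen Q.Adj j k := by simp [hA]
  have hkA : k ∈ A := hmem.2 .refl
  have haA : a ∈ A := hmem.2 (.head h₁ hk₁)
  have hdeg : ∀ c ∈ A, 1 + (if c = a then 1 else 0) ≤
      (A.filter (Q.Adj c)).card + if c = k then 1 else 0 := by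
    intro c hc
    by_cases hca : c = a
    · subst hca
      have : 1 < (A.filter (Q.Adj c)).card :=
        Finset.one_lt_card.2 ⟨b₁, by simp [*], b₂, by simp [*], hne⟩
      rw [if_pos rfl]
      omega
    by_cases hck : c = k
    · simp only [if_neg hca, if_pos hck, add_zero, le_add_iff_nonneg_left, zero_le]
    obtain ⟨d, hcd, hdk⟩ := (hmem.1 hc).cases_head.resolve_left hck
    have : 0 < (A.filter (Q.Adj c)).card := Finset.card_pos.2 ⟨d, by simp [*]⟩
    rw [if_neg hca, if_neg hck]
    omega
  have hsum := Finset.sum_le_sum hdeg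
  have hlt := hQ.sum_card_adj_lt hC ⟨k, hkA⟩
  simp only [Finset.sum_add_distrib, Finset.sum_ite_eq', haA, hkA, if_true, Finset.sum_const,
    smul_eq_mul, mul_one] at hsum
  omega

theorem IsOrientationOf.pred_unique [Finite V] (hC : IsPosSimplyLaced C)
    (hQ : IsOrientationOf Q C) (hξ : IsHeightFunction Q ξ) {k i i' a : V} (hi : Q.Adj i k)
    (hi' : Q.Adj i' k) (ha : Relation.ReflTransGen Q.Adj a i)
    (ha' : Relation.ReflTransGen Q.Adj a i') :
    i = i' := by
  have hheight : ξ i = ξ i' := by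
    have := hξ _ _ hi
    have := hξ _ _ hi'
    omega
  induction ha using Relation.ReflTransGen.head_induction_on with
  | refl => exact (hξ.eq_or_lt ha').resolve_right (by omega)
  | head hab hbi ih =>
    rcases ha'.cases_head with rfl | ⟨d, had, hdi'⟩
    · exact ((hξ.eq_or_lt (.head hab hbi)).resolve_right (by omega)).symm
    · obtain rfl := hQ.succ_unique hC hab had (hbi.tail hi) (hdi'.tail hi')
      exact ih hdi'

variable [Fintype V]

/-- The vector of the root `γ_i` in the root lattice. -/
def gammaVec (Q : Digraph V) (i : V) : V → ℤ :=
  ∑ j with Relation.ReflTransGen Q.Adj j i, simple j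

theorem gammaVec_apply (Q : Digraph V) (i a : V) :
    gammaVec Q i a = if Relation.ReflTransGen Q.Adj a i then 1 else 0 := by
  simp [gammaVec, simple_apply]

theorem IsOrientationOf.gammaVec_eq (hC : IsPosSimplyLaced C) (hQ : IsOrientationOf Q C)
    (hξ : IsHeightFunction Q ξ) (k : V) :
    gammaVec Q k = simple k + ∑ i with Q.Adj i k, gammaVec Q i := by
  ext a
  rw [Pi.add_apply, Finset.sum_apply, gammaVec_apply, simple_apply]
  simp only [gammaVec_apply]
  obtain rfl | hak := eq_or_ne a k
  · rw [if_pos .refl, if_pos rfl, Finset.sum_eq_zero, add_zero]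
    intro i hi
    exact if_neg (hξ.not_reflTransGen_of_adj (Finset.mem_filter.1 hi).2)
  rw [if_neg hak, zero_add]
  by_cases h : Relation.ReflTransGen Q.Adj a k
  · obtain ⟨i, hai, hik⟩ := h.cases_tail.resolve_left hak.symm
    rw [if_pos h, Finset.sum_eq_single i, if_pos hai]
    · intro i' hi' hne
      refine if_neg fun hai' => hne ?_
      exact hQ.pred_unique hC hξ (Finset.mem_filter.1 hi').2 hik hai' hai
    · simp [hik]
  · rw [if_neg h, Finset.sum_eq_zero]
    intro i hi
    exact if_neg fun hai => h (hai.tail (Finset.mem_filter.1 hi).2)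

/-- The product `s_{i₁} ⋯ s_{i_k}` of simple reflections of the root lattice given by a word. -/
def IsPosSimplyLaced.wordProd (hC : IsPosSimplyLaced C) (l : List V) : (V → ℤ) ≃ₗ[ℤ] (V → ℤ) :=
  (l.map hC.refl).prod

theorem IsOrientationOf.simple_sub_sum_eq_gammaVec (hC : IsPosSimplyLaced C)
    (hQ : IsOrientationOf Q C) (hξ : IsHeightFunction Q ξ) {s : Finset V} {i : V} (his : i ∉ s)
    (hsucc : ∀ j ∈ s, ¬ Q.Adj i j) (hpred : ∀ j, Q.Adj j i → j ∈ s) :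
    simple i - ∑ j ∈ s, C i j • gammaVec Q j = gammaVec Q i := by
  have hentry : ∀ j ∈ s, C i j = if Q.Adj j i then -1 else 0 := fun j hj => by
    rw [hQ.entry_eq hC, if_neg (ne_of_mem_of_not_mem hj his).symm, if_neg (hsucc j hj)]
    split_ifs <;> simp
  have hpreds : s.filter (Q.Adj · i) = ({j | Q.Adj j i} : Finset V) := by
    ext j
    simpa using hpred j
  rw [hQ.gammaVec_eq hC hξ i, ← hpreds, Finset.sum_filter, sub_eq_add_neg,
    ← Finset.sum_neg_distrib]
  congr 1
  refine Finset.sum_congr rfl fun j hj => ?_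
  rw [hentry j hj]
  split_ifs <;> simp

/-- The product over an initial segment of an adapted word maps the next simple root `α_i`
to `γ_i`. -/
theorem IsOrientationOf.wordProd_apply (hC : IsPosSimplyLaced C) (hQ : IsOrientationOf Q C)
    (hξ : IsHeightFunction Q ξ) {l : List V} (hl : l.Nodup)
    (hadj : l.Pairwise fun a b => ¬ Q.Adj b a) (hpred : ∀ a ∈ l, ∀ j, Q.Adj j a → j ∈ l)
    (v : V → ℤ) :
    hC.wordProd l v = v - ∑ j ∈ l.toFinset, latticeForm C v (simple j) • gammaVec Q j := by
  induction l using List.reverseRecOn generalizing v with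
  | nil => simp [IsPosSimplyLaced.wordProd]
  | append_singleton l i ih =>
    obtain ⟨hl, hil⟩ : l.Nodup ∧ i ∉ l := by simpa using List.nodup_append'.1 hl
    obtain ⟨hadj, hi⟩ : l.Pairwise (fun a b => ¬ Q.Adj b a) ∧ ∀ a ∈ l, ¬ Q.Adj i a := by
      simpa using List.pairwise_append.1 hadj
    replace ih := ih hl hadj fun a ha j hja => by
      refine (List.mem_append.1 (hpred a (by simp [ha]) j hja)).resolve_right fun hj => ?_
      exact hi a ha (List.mem_singleton.1 hj ▸ hja)
    have hgamma : hC.wordProd l (simple i) = gammaVec Q i := by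
      simp only [ih, latticeForm_simple]
      refine hQ.simple_sub_sum_eq_gammaVec hC hξ (by simpa using hil) (by simpa using hi) ?_
      intro j hj
      simpa [hQ.ne_of_adj hj] using hpred i (by simp) j hj
    have hsnoc : hC.wordProd (l ++ [i]) v = hC.wordProd l (hC.refl i v) := by
      simp [IsPosSimplyLaced.wordProd]
    have hinsert : (l ++ [i]).toFinset = insert i l.toFinset := by ext; simp
    rw [hsnoc, hC.refl_apply, map_sub, map_smul, hgamma, ih, hinsert,
      Finset.sum_insert (by simpa using hil)]
    abel

theorem IsCoxeterWord.wordProd_apply {l : List V} (hl : IsCoxeterWord Q l)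
    (hC : IsPosSimplyLaced C) (hQ : IsOrientationOf Q C) (hξ : IsHeightFunction Q ξ) (v : V → ℤ) :
    hC.wordProd l v = v - ∑ j, latticeForm C v (simple j) • gammaVec Q j := by
  have huniv : l.toFinset = Finset.univ := Finset.eq_univ_of_forall (by simpa using hl.2.1)
  rw [hQ.wordProd_apply hC hξ hl.1 (hl.2.2.pairwise_not_adj hl.1) fun _ _ j _ => hl.2.1 j, huniv]

end Quiver

section MeshFamily

variable {V : Type*} [Fintype V] {C : Matrix V V ℤ} {ξ : V → ℤ} {r : V → ℤ → V → ℤ}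

/-- A family of lattice vectors `r k s` which vanishes unless `s ∈ ξ k + 2ℤ_{≤0}` and satisfies the
mesh relations of the repetition quiver, the missing vector `r k (ξ k + 2)` at the boundary being
replaced by `-α_k`. -/
structure IsMeshFamily (C : Matrix V V ℤ) (ξ : V → ℤ) (r : V → ℤ → V → ℤ) : Prop where
  height : ∀ {j k}, C j k = -1 → ξ j = ξ k + 1 ∨ ξ j = ξ k - 1
  eq_zero : ∀ {k s}, ¬ (s ≤ ξ k ∧ 2 ∣ ξ k - s) → r k s = 0
  mesh : ∀ k s, r k (s + 1) + r k (s - 1) =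
    (∑ j with C j k = -1, r j s) + if s = ξ k + 1 then simple k else 0

theorem IsOrientationOf.coxeter_gammaVec (hC : IsPosSimplyLaced C) {Q : Digraph V}
    (hQ : IsOrientationOf Q C) (hξ : IsHeightFunction Q ξ) {τ : (V → ℤ) ≃ₗ[ℤ] (V → ℤ)}
    (hτ : ∀ v, τ v = v - ∑ j, latticeForm C v (simple j) • gammaVec Q j) (k : V) :
    gammaVec Q k + τ (gammaVec Q k) =
      (∑ j with Q.Adj j k, τ (gammaVec Q j)) + ∑ j with Q.Adj k j, gammaVec Q j := by
  have hentry : ∑ j, C k j • gammaVec Q j = gammaVec Q k + gammaVec Q k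
      - ∑ j with Q.Adj k j, gammaVec Q j - ∑ j with Q.Adj j k, gammaVec Q j := by
    simp only [hQ.entry_eq hC, sub_smul, mul_smul, ite_smul, one_smul, zero_smul, two_smul,
      Finset.sum_sub_distrib, Finset.sum_add_distrib, Finset.sum_ite_eq, Finset.mem_univ, if_true,
      Finset.sum_filter]
  have hsimple : simple k = gammaVec Q k - ∑ j with Q.Adj j k, gammaVec Q j :=
    eq_sub_of_add_eq (hQ.gammaVec_eq hC hξ k).symm
  have h := hτ (simple k)
  simp only [latticeForm_simple, hentry] at h
  rw [hsimple, map_sub, map_sum, sub_eq_iff_eq_add] at h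
  rw [h]
  abel

/-- The root `τ ^ m γ_k`, placed at `(k, ξ k - 2 * m)`; it is `β_{k, ξ k - 2 * m}` up to sign. It is
extended by zero to all `(k, s)`. -/
def signedRoot (Q : Digraph V) (ξ : V → ℤ) (τ : (V → ℤ) ≃ₗ[ℤ] (V → ℤ)) (k : V) (s : ℤ) : V → ℤ :=
  if s ≤ ξ k ∧ 2 ∣ ξ k - s then (τ ^ ((ξ k - s) / 2).toNat) (gammaVec Q k) else 0

theorem signedRoot_of_eq (Q : Digraph V) {τ : (V → ℤ) ≃ₗ[ℤ] (V → ℤ)} {k : V} {s : ℤ} {m : ℕ}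
    (h : s = ξ k - 2 * m) : signedRoot Q ξ τ k s = (τ ^ m) (gammaVec Q k) := by
  rw [signedRoot, if_pos (by omega), show ((ξ k - s) / 2).toNat = m by omega]

theorem signedRoot_eq_zero {Q : Digraph V} {τ : (V → ℤ) ≃ₗ[ℤ] (V → ℤ)} {k : V} {s : ℤ}
    (h : ¬ (s ≤ ξ k ∧ 2 ∣ ξ k - s)) : signedRoot Q ξ τ k s = 0 :=
  if_neg h

theorem IsOrientationOf.sum_neighbors {Q : Digraph V} (hQ : IsOrientationOf Q C)
    (f : V → V → ℤ) (k : V) :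
    ∑ j with C j k = -1, f j = (∑ j with Q.Adj j k, f j) + ∑ j with Q.Adj k j, f j := by
  rw [← Finset.sum_union]
  · refine Finset.sum_congr ?_ fun _ _ => rfl
    ext j
    simp [← hQ.adj_or_adj_iff]
  · exact Finset.disjoint_filter.2 fun j _ => hQ.asymm j k

theorem IsOrientationOf.isMeshFamily_signedRoot (hC : IsPosSimplyLaced C) {Q : Digraph V}
    (hQ : IsOrientationOf Q C) (hξ : IsHeightFunction Q ξ) {τ : (V → ℤ) ≃ₗ[ℤ] (V → ℤ)}
    (hτ : ∀ v, τ v = v - ∑ j, latticeForm C v (simple j) • gammaVec Q j) :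
    IsMeshFamily C ξ (signedRoot Q ξ τ) where
  height {j k} h := by
    rcases (hQ.adj_or_adj_iff j k).2 h with h | h <;> have := hξ _ _ h <;> omega
  eq_zero h := signedRoot_eq_zero h
  mesh k s := by
    have hpred : ∀ j ∈ ({j | Q.Adj j k} : Finset V), ξ j = ξ k + 1 := fun j hj => by
      have := hξ j k (Finset.mem_filter.1 hj).2
      omega
    have hsucc : ∀ j ∈ ({j | Q.Adj k j} : Finset V), ξ j = ξ k - 1 := fun j hj =>
      hξ k j (Finset.mem_filter.1 hj).2
    rw [hQ.sum_neighbors]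
    by_cases hs : s ≤ ξ k + 1 ∧ 2 ∣ ξ k + 1 - s
    · obtain ⟨m, hm⟩ : ∃ m : ℕ, s = ξ k + 1 - 2 * m := ⟨((ξ k + 1 - s) / 2).toNat, by omega⟩
      have hdown : signedRoot Q ξ τ k (s - 1) = (τ ^ m) (gammaVec Q k) :=
        signedRoot_of_eq Q (by omega)
      rw [hdown, Finset.sum_congr rfl fun j hj =>
        signedRoot_of_eq Q (m := m) (show s = ξ j - 2 * m by rw [hpred j hj]; omega)]
      rcases m with _ | m
      · have hup : signedRoot Q ξ τ k (s + 1) = 0 := signedRoot_eq_zero (by omega)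
        rw [hup, if_pos (by omega), Finset.sum_eq_zero fun j hj =>
          signedRoot_eq_zero (by rw [hsucc j hj]; omega)]
        simp [hQ.gammaVec_eq hC hξ k, add_comm]
      · have hup : signedRoot Q ξ τ k (s + 1) = (τ ^ m) (gammaVec Q k) :=
          signedRoot_of_eq Q (by push_cast at hm; omega)
        rw [hup, if_neg (by omega), Finset.sum_congr rfl fun j hj => signedRoot_of_eq Q (m := m)
          (show s = ξ j - 2 * m by rw [hsucc j hj]; push_cast at hm; omega)]
        simpa [pow_succ] using congrArg (τ ^ m) (hQ.coxeter_gammaVec hC hξ hτ k)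
    · have hup : signedRoot Q ξ τ k (s + 1) = 0 := signedRoot_eq_zero (by omega)
      have hdown : signedRoot Q ξ τ k (s - 1) = 0 := signedRoot_eq_zero (by omega)
      rw [hup, hdown, if_neg (by omega),
        Finset.sum_eq_zero fun j hj => signedRoot_eq_zero (by rw [hpred j hj]; omega),
        Finset.sum_eq_zero fun j hj => signedRoot_eq_zero (by rw [hsucc j hj]; omega)]
      simp

theorem IsPosSimplyLaced.sum_entry_smul (hC : IsPosSimplyLaced C) (f : V → V → ℤ) (k : V) :
    ∑ j, C k j • f j = 2 • f k - ∑ j with C j k = -1, f j := by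
  have hentry : ∀ j, C k j • f j = (if k = j then 2 • f j else 0) - if C j k = -1 then f j else 0 :=
    fun j => by
      obtain rfl | hkj := eq_or_ne k j
      · simp [hC.diag]
      · rcases hC.simplyLaced hkj with h | h <;> simp [h, hkj, hC.symm j k]
  rw [Finset.sum_congr rfl fun j _ => hentry j, Finset.sum_sub_distrib, Finset.sum_ite_eq,
    if_pos (Finset.mem_univ k), Finset.sum_filter]

/-- The image of `α_k` under the Weyl group element `w` of `IsTruncation`. -/
def truncatedVec (r : V → ℤ → V → ℤ) (ξ : V → ℤ) (t : ℤ) (k : V) : V → ℤ :=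
  r k t - r k (t + 1) + if ξ k < t then simple k else 0

/-- `w` is the Weyl group element with inversions `± r j s` for `t < s ≤ T`, namely the product of
the corresponding initial segment of the sequence of simple reflections adapted to `ξ`. -/
structure IsTruncation (C : Matrix V V ℤ) (ξ : V → ℤ) (r : V → ℤ → V → ℤ) (T t : ℤ)
    (w : (V → ℤ) ≃ₗ[ℤ] (V → ℤ)) : Prop where
  form_map : ∀ u v, latticeForm C (w u) (w v) = latticeForm C u v
  map_simple : ∀ k, w (simple k) = truncatedVec r ξ t k
  negInd_symm : ∀ β, latticeForm C β β = 2 →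
    negInd (w.symm β) = negInd β + ∑ s ∈ Finset.Ioc t T, ∑ j, relSign (r j s) β

namespace IsMeshFamily

theorem entry_eq_zero (hr : IsMeshFamily C ξ r) (hC : IsPosSimplyLaced C) {i j : V}
    (hij : i ≠ j) (hpar : 2 ∣ ξ i - ξ j) : C i j = 0 :=
  (hC.simplyLaced hij).resolve_right fun h => by
    rcases hr.height h with h | h <;> omega

theorem truncatedVec_of_mem (hr : IsMeshFamily C ξ r) {k : V} {t : ℤ}
    (h : t ≤ ξ k ∧ 2 ∣ ξ k - t) : truncatedVec r ξ t k = r k t := by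
  rw [truncatedVec, hr.eq_zero (s := t + 1) (by omega), if_neg (by omega), sub_zero, add_zero]

theorem truncatedVec_sub_one_of_mem (hr : IsMeshFamily C ξ r) {k : V} {t : ℤ}
    (h : t ≤ ξ k ∧ 2 ∣ ξ k - t) : truncatedVec r ξ (t - 1) k = -r k t := by
  rw [truncatedVec, hr.eq_zero (s := t - 1) (by omega), if_neg (by omega), sub_add_cancel,
    zero_sub, add_zero]

theorem truncatedVec_sub_one (hr : IsMeshFamily C ξ r) (hC : IsPosSimplyLaced C) (t : ℤ) (k : V) :
    truncatedVec r ξ (t - 1) k = truncatedVec r ξ t k - ∑ j, C k j • r j t := by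
  have hboundary : (if ξ k < t then simple k else 0) =
      (if t = ξ k + 1 then simple k else 0) + if ξ k < t - 1 then simple k else 0 := by
    split_ifs <;> first | omega | simp
  have hmesh := hr.mesh k t
  rw [hC.sum_entry_smul, truncatedVec, truncatedVec, hboundary, sub_add_cancel]
  linear_combination (exp := 1) (1 : ℤ) • hmesh

theorem isTruncation_refl (hr : IsMeshFamily C ξ r) {T : ℤ} (hT : ∀ k, ξ k < T) :
    IsTruncation C ξ r T T (LinearEquiv.refl ℤ (V → ℤ)) where
  form_map _ _ := rfl
  map_simple k := by
    have := hT k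
    rw [truncatedVec, hr.eq_zero (by omega), hr.eq_zero (by omega), if_pos this]
    simp
  negInd_symm := by simp

/-- The `j` with `(j, t)` in the support are pairwise non-adjacent in the Dynkin diagram, so the
step from `t` to `t - 1` is a product of commuting reflections. -/
theorem exists_isTruncation_sub_one (hr : IsMeshFamily C ξ r) (hC : IsPosSimplyLaced C) {T t : ℤ}
    (ht : t ≤ T) {w : (V → ℤ) ≃ₗ[ℤ] (V → ℤ)} (hw : IsTruncation C ξ r T t w) :
    ∃ w', IsTruncation C ξ r T (t - 1) w' := by
  let J : Finset V := {j | t ≤ ξ j ∧ 2 ∣ ξ j - t}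
  have hmem : ∀ {j}, j ∈ J ↔ t ≤ ξ j ∧ 2 ∣ ξ j - t := by simp [J]
  have hlevel : ∀ j ∈ J, w (simple j) = r j t := fun j hj => by
    rw [hw.map_simple, hr.truncatedVec_of_mem (hmem.1 hj)]
  have hzero : ∀ j ∉ J, r j t = 0 := fun j hj => hr.eq_zero fun h => hj (hmem.2 h)
  obtain ⟨R, hR, hRv, hRneg⟩ := hC.exists_prod_refl_of_orthogonal J fun i hi j hj hij =>
    hr.entry_eq_zero hC hij (by have := hmem.1 hi; have := hmem.1 hj; omega)
  refine ⟨R.trans w, fun u v => ?_, fun k => ?_, fun β hβ => ?_⟩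
  · rw [LinearEquiv.trans_apply, LinearEquiv.trans_apply, hw.form_map, hR]
  · have hsum : ∑ j, C k j • r j t = ∑ j ∈ J, C k j • w (simple j) := by
      rw [← Finset.sum_subset (Finset.subset_univ J) fun j _ hj => by rw [hzero j hj, smul_zero]]
      exact Finset.sum_congr rfl fun j hj => by rw [hlevel j hj]
    rw [LinearEquiv.trans_apply, hRv, map_sub, map_sum, hr.truncatedVec_sub_one hC, hsum,
      hw.map_simple]
    simp only [map_smul, latticeForm_simple]
  · have hsum : ∑ j, relSign (r j t) β = ∑ j ∈ J, relSign (simple j) (w.symm β) := by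
      rw [← Finset.sum_subset (Finset.subset_univ J) fun j _ hj => by
        rw [hzero j hj, relSign_zero_left]]
      refine Finset.sum_congr rfl fun j hj => ?_
      rw [← hlevel j hj, ← relSign_map w (simple j), w.apply_symm_apply]
    have hβ' : latticeForm C (w.symm β) (w.symm β) = 2 := by
      rw [← hw.form_map, w.apply_symm_apply, hβ]
    have hIoc : Finset.Ioc (t - 1) T = insert t (Finset.Ioc t T) := by
      ext s
      simp only [Finset.mem_Ioc, Finset.mem_insert]
      omega
    rw [LinearEquiv.trans_symm, LinearEquiv.trans_apply, hRneg _ hβ', hw.negInd_symm β hβ, ← hsum,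
      hIoc, Finset.sum_insert (by simp)]
    ring

theorem exists_isTruncation (hr : IsMeshFamily C ξ r) (hC : IsPosSimplyLaced C) {T : ℤ}
    (hT : ∀ k, ξ k < T) {t : ℤ} (ht : t ≤ T) : ∃ w, IsTruncation C ξ r T t w := by
  induction t, ht using Int.leInductionDown with
  | base => exact ⟨_, hr.isTruncation_refl hT⟩
  | pred t ht ih =>
    obtain ⟨w, hw⟩ := ih
    exact hr.exists_isTruncation_sub_one hC ht hw

theorem form_truncatedVec (hr : IsMeshFamily C ξ r) (hC : IsPosSimplyLaced C) (t : ℤ) (j k : V) :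
    latticeForm C (truncatedVec r ξ t j) (truncatedVec r ξ t k) = C j k := by
  obtain ⟨M, hM⟩ := (Set.finite_range ξ).bddAbove
  have hT : ∀ k, ξ k < max t (M + 1) := fun k =>
    lt_max_of_lt_right (Int.lt_add_one_of_le (hM ⟨k, rfl⟩))
  obtain ⟨w, hw⟩ := hr.exists_isTruncation hC hT (le_max_left t (M + 1))
  rw [← hw.map_simple, ← hw.map_simple, hw.form_map, latticeForm_simple]

theorem form_self (hr : IsMeshFamily C ξ r) (hC : IsPosSimplyLaced C) {k : V} {s : ℤ}
    (h : s ≤ ξ k ∧ 2 ∣ ξ k - s) : latticeForm C (r k s) (r k s) = 2 := by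
  rw [← hr.truncatedVec_of_mem h, hr.form_truncatedVec hC, hC.diag]

end IsMeshFamily

/-- The entries of `c`, read as the coefficients of power series `∑ m, c j m * z ^ m` without
constant term, form the `i`-th row of the inverse of the quantum Cartan matrix of `C`. -/
structure IsInverseRow (C : Matrix V V ℤ) (i : V) (c : V → ℤ → ℤ) : Prop where
  eq_zero : ∀ j {m}, m ≤ 0 → c j m = 0
  add : ∀ j m, c j (m + 1) + c j (m - 1) =
    (∑ k with C k j = -1, c k m) + if m = 0 ∧ i = j then 1 else 0

namespace IsInverseRow

variable {i : V} {c : V → ℤ → ℤ}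

theorem apply_one (hc : IsInverseRow C i c) (j : V) : c j 1 = if i = j then 1 else 0 := by
  have h := hc.add j 0
  rw [hc.eq_zero j (m := 0 - 1) (by omega), Finset.sum_eq_zero fun k _ => hc.eq_zero k le_rfl] at h
  simpa using h

theorem apply_two (hc : IsInverseRow C i c) (j : V) : c j 2 = if C i j = -1 then 1 else 0 := by
  have h := hc.add j 1
  norm_num [hc.eq_zero, hc.apply_one] at h
  exact h

end IsInverseRow

namespace IsMeshFamily

variable {i j : V} {p : ℤ}

theorem form_sub_form (hr : IsMeshFamily C ξ r) (hC : IsPosSimplyLaced C)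
    (hi : p ≤ ξ i ∧ 2 ∣ ξ i - p) (hj : p ≤ ξ j) :
    latticeForm C (r i p) (r j p) - latticeForm C (r i p) (r j (p + 1)) = C i j := by
  rw [← map_sub, ← hr.form_truncatedVec hC p i j, hr.truncatedVec_of_mem hi, truncatedVec,
    if_neg hj.not_gt, add_zero]

theorem form_apply_self (hr : IsMeshFamily C ξ r) (hC : IsPosSimplyLaced C)
    (hi : p ≤ ξ i ∧ 2 ∣ ξ i - p) (hj : p ≤ ξ j) :
    latticeForm C (r i p) (r j p) = if i = j then 2 else 0 := by
  have h := hr.form_sub_form hC hi hj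
  by_cases hpar : 2 ∣ ξ j - p
  · rw [hr.eq_zero (s := p + 1) (by omega), map_zero, sub_zero] at h
    rw [h]
    split_ifs with hij
    · rw [hij, hC.diag]
    · exact hr.entry_eq_zero hC hij (by omega)
  · rw [hr.eq_zero (k := j) (s := p) (by omega), map_zero, if_neg]
    rintro rfl
    exact hpar hi.2

theorem form_apply_add_one (hr : IsMeshFamily C ξ r) (hC : IsPosSimplyLaced C)
    (hi : p ≤ ξ i ∧ 2 ∣ ξ i - p) (hj : p ≤ ξ j) :
    latticeForm C (r i p) (r j (p + 1)) = if C i j = -1 then 1 else 0 := by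
  have h := hr.form_sub_form hC hi hj
  rw [hr.form_apply_self hC hi hj] at h
  obtain rfl | hij := eq_or_ne i j
  · rw [if_pos rfl, hC.diag] at h
    rw [hC.diag, if_neg (by norm_num)]
    omega
  · rw [if_neg hij] at h
    rcases hC.simplyLaced hij with h' | h' <;> rw [h'] at h ⊢ <;> simp <;> omega

theorem form_eq (hr : IsMeshFamily C ξ r) (hC : IsPosSimplyLaced C) {c : V → ℤ → ℤ}
    (hc : IsInverseRow C i c) (hi : p ≤ ξ i ∧ 2 ∣ ξ i - p) (n : ℕ) (hj : p + n ≤ ξ j) :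
    latticeForm C (r i p) (r j (p + n)) =
      c j (n + 1) - c j (n - 1) + if n = 0 ∧ i = j then 1 else 0 := by
  induction n using Nat.twoStepInduction generalizing j with
  | zero =>
    rw [Nat.cast_zero, add_zero, hr.form_apply_self hC hi (by simpa using hj), zero_add,
      hc.apply_one, hc.eq_zero j (m := 0 - 1) (by omega)]
    split_ifs <;> simp_all
  | one =>
    rw [Nat.cast_one, hr.form_apply_add_one hC hi (by omega), one_add_one_eq_two, hc.apply_two,
      hc.eq_zero j (m := 1 - 1) (by omega), if_neg (c := 1 = 0 ∧ i = j) (by simp), sub_zero,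
      add_zero]
  | more n ih ih' =>
    push_cast at hj ih' ⊢
    simp only [false_and, if_false, add_zero] at ih' ⊢
    have hnbr : ∑ k with C k j = -1, latticeForm C (r i p) (r k (p + (n + 1))) =
        ∑ k with C k j = -1, (c k (n + 2) - c k n) := by
      refine Finset.sum_congr rfl fun k hk => ?_
      rw [ih' (j := k) (by rcases hr.height (Finset.mem_filter.1 hk).2 with h | h <;> omega)]
      ring_nf
    have hmesh := congrArg (latticeForm C (r i p)) (hr.mesh j (p + (n + 1)))
    rw [if_neg (by omega), add_zero, map_add, map_sum, hnbr, Finset.sum_sub_distrib,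
      show p + ((n : ℤ) + 1) - 1 = p + n by ring, ih (j := j) (by omega)] at hmesh
    have hup := hc.add j (n + 2)
    have hdown := hc.add j n
    rw [if_neg (by omega)] at hup
    simp only [Nat.cast_eq_zero] at hdown
    ring_nf at hmesh hup hdown ⊢
    linarith

theorem exponent_eq (hr : IsMeshFamily C ξ r) (hC : IsPosSimplyLaced C) {c : V → ℤ → ℤ}
    (hc : IsInverseRow C i c) (hi : p ≤ ξ i ∧ 2 ∣ ξ i - p) {s : ℤ} (hps : p ≤ s) (hj : s ≤ ξ j) :
    c j (s - p - 1) - c j (s - p + 1) =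
      -latticeForm C (r i p) (r j s) + if s = p ∧ j = i then 1 else 0 := by
  obtain ⟨n, rfl⟩ := Int.le.dest hps
  rw [hr.form_eq hC hc hi n hj, add_sub_cancel_left]
  simp only [add_eq_left, Nat.cast_eq_zero, eq_comm (a := j)]
  ring

theorem sum_exponent_eq (hr : IsMeshFamily C ξ r) (hC : IsPosSimplyLaced C) {c : V → ℤ → ℤ}
    (hc : IsInverseRow C i c) (hi : p ≤ ξ i ∧ 2 ∣ ξ i - p) {T : ℤ} (hT : p ≤ T) {β : V → ℤ}
    (hβ : β ≠ 0) :
    ∑ s ∈ Finset.Ioc (p - 1) T, ∑ j,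
        (if r j s = β ∨ r j s = -β then c j (s - p - 1) - c j (s - p + 1) else 0) =
      -latticeForm C (r i p) β * (∑ s ∈ Finset.Ioc (p - 1) T, ∑ j, relSign (r j s) β) +
        if r i p = β ∨ r i p = -β then 1 else 0 := by
  have hterm : ∀ s ∈ Finset.Ioc (p - 1) T, ∀ j,
      (if r j s = β ∨ r j s = -β then c j (s - p - 1) - c j (s - p + 1) else 0) =
        -latticeForm C (r i p) β * relSign (r j s) β +
          if s = p ∧ j = i then if r i p = β ∨ r i p = -β then 1 else 0 else 0 := fun s hs j => by
    by_cases h : r j s = β ∨ r j s = -β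
    · have hsupp : s ≤ ξ j ∧ 2 ∣ ξ j - s := by
        by_contra hcon
        rw [hr.eq_zero hcon, zero_eq_neg, eq_comm, or_self] at h
        exact hβ h
      have hps : p ≤ s := by have := Finset.mem_Ioc.1 hs; omega
      rw [if_pos h, hr.exponent_eq hC hc hi hps hsupp.1]
      congr 1
      · rcases h with h | h <;> simp [h, relSign, self_eq_neg, hβ]
      · refine if_ctx_congr Iff.rfl (fun hp => ?_) fun _ => rfl
        rw [if_pos (hp.1 ▸ hp.2 ▸ h)]
    · have hnot : ¬ ((s = p ∧ j = i) ∧ (r i p = β ∨ r i p = -β)) := by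
        rintro ⟨⟨rfl, rfl⟩, h'⟩
        exact h h'
      rw [not_or] at h
      rw [if_neg (not_or.2 h), ← ite_and, if_neg hnot, relSign, if_neg (Ne.symm h.1),
        if_neg fun h' => h.2 (by rw [h', neg_neg])]
      simp
  rw [Finset.sum_congr rfl fun s hs => Finset.sum_congr rfl fun j _ => hterm s hs j]
  simp only [Finset.sum_add_distrib, Finset.mul_sum]
  congr 1
  simp only [ite_and, Finset.sum_ite_eq', Finset.sum_ite_irrel,
    Finset.sum_const_zero, Finset.mem_univ, if_true]
  rw [if_pos (by simp [hT])]

theorem abs_sum_exponent_le (hr : IsMeshFamily C ξ r) (hC : IsPosSimplyLaced C) {c : V → ℤ → ℤ}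
    (hc : IsInverseRow C i c) (hi : p ≤ ξ i ∧ 2 ∣ ξ i - p) {T : ℤ} (hT : ∀ k, ξ k < T)
    {β : V → ℤ} (hβ : latticeForm C β β = 2) (hpos : 0 ≤ β) :
    |∑ s ∈ Finset.Ioc (p - 1) T, ∑ j,
      if r j s = β ∨ r j s = -β then c j (s - p - 1) - c j (s - p + 1) else 0| ≤ 1 := by
  have hβ0 : β ≠ 0 := by rintro rfl; simp at hβ
  have hpT : p ≤ T := hi.1.trans (hT i).le
  obtain ⟨w, hw⟩ := hr.exists_isTruncation hC hT (t := p - 1) (by omega)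
  have hinv : ∑ s ∈ Finset.Ioc (p - 1) T, ∑ j, relSign (r j s) β = negInd (w.symm β) := by
    rw [hw.negInd_symm β hβ, negInd, if_neg fun h => hβ0 (le_antisymm h hpos), zero_add]
  have hwi : r i p = -w (simple i) := by
    rw [hw.map_simple, hr.truncatedVec_sub_one_of_mem hi, neg_neg]
  have hself := hr.form_self hC hi
  rw [hr.sum_exponent_eq hC hc hi hpT hβ0, hinv]
  by_cases h : r i p = β
  · have hN : negInd (w.symm β) = 1 := by
      rw [← h, hwi, map_neg, w.symm_apply_apply, negInd_neg_simple]
    rw [if_pos (Or.inl h), hN, h, hβ]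
    norm_num
  by_cases h' : r i p = -β
  · have hN : negInd (w.symm β) = 0 := by
      rw [← neg_neg β, ← h', hwi, neg_neg, w.symm_apply_apply, negInd_simple]
    rw [if_pos (Or.inr h'), hN]
    norm_num
  · have hle := hC.form_le_one hself hβ h
    have hge := hC.neg_one_le_form hself hβ h'
    rw [if_neg (not_or.2 ⟨h, h'⟩), negInd, abs_le]
    split_ifs <;> constructor <;> linarith

end IsMeshFamily
end MeshFamily

section QuantumCartan

variable {V : Type*} [Fintype V]

theorem coeff_mul_single_add_single (f : LaurentSeries ℤ) (m : ℤ) :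
    (f * (HahnSeries.single 1 1 + HahnSeries.single (-1) 1)).coeff m =
      f.coeff (m - 1) + f.coeff (m + 1) := by
  have hdown := HahnSeries.coeff_mul_single_add (x := f) (r := (1 : ℤ)) (a := m - 1) (b := (1 : ℤ))
  have hup := HahnSeries.coeff_mul_single_add (x := f) (r := (1 : ℤ)) (a := m + 1) (b := (-1 : ℤ))
  rw [sub_add_cancel, mul_one] at hdown
  rw [add_neg_cancel_right, mul_one] at hup
  rw [mul_add, HahnSeries.coeff_add, hdown, hup]

theorem coeff_sum_mul_quantumCartan {C : Matrix V V ℤ} (hC : IsPosSimplyLaced C)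
    (f : V → LaurentSeries ℤ) (j : V) (m : ℤ) :
    (∑ k, f k * quantumCartan C k j).coeff m =
      (f j).coeff (m + 1) + (f j).coeff (m - 1) - ∑ k with C k j = -1, (f k).coeff m := by
  have hterm : ∀ k, f k * quantumCartan C k j =
      (if k = j then f k * (HahnSeries.single 1 1 + HahnSeries.single (-1) 1) else 0) -
        if C k j = -1 then f k else 0 := fun k => by
    obtain rfl | hkj := eq_or_ne k j
    · simp [quantumCartan, hC.diag]
    · by_cases h : C k j = -1 <;> simp [quantumCartan, hkj, h]
  rw [Finset.sum_congr rfl fun k _ => hterm k, Finset.sum_sub_distrib, Finset.sum_ite_eq',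
    if_pos (Finset.mem_univ j), HahnSeries.coeff_sub, coeff_mul_single_add_single, add_comm,
    ← Finset.sum_filter, HahnSeries.coeff_sum]

theorem coeff_inv_quantumCartan {C : Matrix V V ℤ} (hC : IsPosSimplyLaced C) (i j : V) (m : ℤ) :
    ((quantumCartan C)⁻¹ i j).coeff (m + 1) + ((quantumCartan C)⁻¹ i j).coeff (m - 1) =
      (∑ k with C k j = -1, ((quantumCartan C)⁻¹ i k).coeff m) +
        if m = 0 ∧ i = j then 1 else 0 := by
  have h := congrFun₂ (Matrix.nonsing_inv_mul _ (isUnit_det_quantumCartan C)) i j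
  rw [Matrix.mul_apply, Matrix.one_apply] at h
  rw [← sub_eq_iff_eq_add', ← coeff_sum_mul_quantumCartan hC fun k => (quantumCartan C)⁻¹ i k, h]
  by_cases hij : i = j <;> simp [hij, HahnSeries.coeff_one]

theorem coeff_inv_quantumCartan_of_nonpos {C : Matrix V V ℤ} (hC : IsPosSimplyLaced C) (i j : V)
    {m : ℤ} (hm : m ≤ 0) : ((quantumCartan C)⁻¹ i j).coeff m = 0 := by
  obtain ⟨M, hM⟩ := (Set.finite_range fun j => ((quantumCartan C)⁻¹ i j).order).bddBelow
  suffices h : ∀ n : ℕ, ∀ j m, m < M + n → m ≤ 0 → ((quantumCartan C)⁻¹ i j).coeff m = 0 from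
    h (m + 1 - M).toNat j m (by omega) hm
  intro n
  induction n with
  | zero =>
    intro j m hmM _
    rw [Nat.cast_zero, add_zero] at hmM
    exact HahnSeries.coeff_eq_zero_of_lt_order (hmM.trans_le (hM ⟨j, rfl⟩))
  | succ n ih =>
    intro j m hmM hm
    push_cast at hmM
    have h := coeff_inv_quantumCartan hC i j (m - 1)
    rwa [sub_add_cancel, if_neg (by omega), ih j (m - 1 - 1) (by omega) (by omega), add_zero,
      Finset.sum_eq_zero fun k _ => ih k (m - 1) (by omega) (by omega), add_zero] at h

theorem isInverseRow_cTilde {C : Matrix V V ℤ} (hC : IsPosSimplyLaced C) (i : V) :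
    IsInverseRow C i (cTilde C i) := by
  have hcoeff : ∀ j m, cTilde C i j m = ((quantumCartan C)⁻¹ i j).coeff m := fun j m => by
    by_cases hm : 1 ≤ m
    · exact if_pos hm
    · rw [cTilde, if_neg hm, coeff_inv_quantumCartan_of_nonpos hC i j (by omega)]
  refine ⟨fun j m hm => if_neg (by omega), fun j m => ?_⟩
  simp only [hcoeff]
  exact coeff_inv_quantumCartan hC i j m

end QuantumCartan

section PrimeOrder

variable {A K : Type*} [CommRing A] [IsDomain A] [Field K] [Algebra A K] [IsFractionRing A K]

theorem exists_eq_algebraMap_div_algebraMap (f : Kˣ) :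
    ∃ a d : A, a ≠ 0 ∧ d ≠ 0 ∧ (f : K) = algebraMap A K a / algebraMap A K d := by
  obtain ⟨a, d, hd, h⟩ := IsFractionRing.div_surjective (A := A) (f : K)
  refine ⟨a, d, ?_, nonZeroDivisors.ne_zero hd, h.symm⟩
  rintro rfl
  rw [map_zero, zero_div] at h
  exact f.ne_zero h.symm

variable [UniqueFactorizationMonoid A]

theorem multiplicity_num_sub_multiplicity_den {p : A} (hp : Prime p) {a d : A} (ha : a ≠ 0)
    (hd : d ≠ 0) {f : K} (hf : f = algebraMap A K a / algebraMap A K d) :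
    (multiplicity p (IsFractionRing.num A f) : ℤ) -
      (multiplicity p (IsFractionRing.den A f : A) : ℤ) = multiplicity p a - multiplicity p d := by
  have hinj := IsFractionRing.injective A K
  have hne : ∀ {x : A}, x ≠ 0 → algebraMap A K x ≠ 0 := (map_ne_zero_iff _ hinj).2
  have hden : (IsFractionRing.den A f : A) ≠ 0 := nonZeroDivisors.coe_ne_zero _
  have hcross : a * (IsFractionRing.den A f : A) = IsFractionRing.num A f * d := by
    apply hinj
    rw [map_mul, map_mul, ← div_eq_div_iff (hne hd) (hne hden), ← hf,
      ← IsFractionRing.mk'_eq_div, IsFractionRing.mk'_num_den]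
  have hnum : IsFractionRing.num A f ≠ 0 := fun h =>
    mul_ne_zero ha hden (by rw [hcross, h, zero_mul])
  have hmult := congrArg (multiplicity p) hcross
  rw [multiplicity_mul hp (.of_prime_left hp (mul_ne_zero ha hden)),
    multiplicity_mul hp (.of_prime_left hp (mul_ne_zero hnum hd))] at hmult
  omega

/-- The order of a fraction at a prime `p`, that is the multiplicity of `p` in its numerator minus
the multiplicity of `p` in its denominator, as a group morphism. -/
def primeOrder {p : A} (hp : Prime p) : Kˣ →* Multiplicative ℤ where
  toFun f := Multiplicative.ofAdd ((multiplicity p (IsFractionRing.num A (f : K)) : ℤ) -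
    (multiplicity p (IsFractionRing.den A (f : K) : A) : ℤ))
  map_one' := by
    rw [multiplicity_num_sub_multiplicity_den hp one_ne_zero one_ne_zero (by simp), sub_self,
      ofAdd_zero]
  map_mul' f g := by
    obtain ⟨a, d, ha, hd, hf⟩ := exists_eq_algebraMap_div_algebraMap (A := A) f
    obtain ⟨a', d', ha', hd', hg⟩ := exists_eq_algebraMap_div_algebraMap (A := A) g
    have hfg : ((f * g : Kˣ) : K) = algebraMap A K (a * a') / algebraMap A K (d * d') := by
      rw [Units.val_mul, hf, hg, map_mul, map_mul, div_mul_div_comm]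
    rw [← ofAdd_add, multiplicity_num_sub_multiplicity_den hp ha hd hf,
      multiplicity_num_sub_multiplicity_den hp ha' hd' hg,
      multiplicity_num_sub_multiplicity_den hp (mul_ne_zero ha ha') (mul_ne_zero hd hd') hfg,
      multiplicity_mul hp (.of_prime_left hp (mul_ne_zero ha ha')),
      multiplicity_mul hp (.of_prime_left hp (mul_ne_zero hd hd'))]
    push_cast
    ring_nf

theorem primeOrder_of_eq_algebraMap {p : A} (hp : Prime p) {a : A} (ha : a ≠ 0) {f : Kˣ}
    (hf : (f : K) = algebraMap A K a) :
    primeOrder hp f = Multiplicative.ofAdd (multiplicity p a : ℤ) := by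
  have h := multiplicity_num_sub_multiplicity_den hp ha one_ne_zero
    (hf.trans (by rw [map_one, div_one]))
  rw [multiplicity_of_one_right hp.not_isUnit, Nat.cast_zero, sub_zero] at h
  exact congrArg Multiplicative.ofAdd h

end PrimeOrder

open scoped Matrix in
theorem posDef_of_posDef_mul_diagonal {V : Type*} [Fintype V] [DecidableEq V] {C : Matrix V V ℤ}
    (hsymm : ∀ i j, C i j = C j i) {d : V → ℤ} (hd : ∀ i, 0 < d i)
    (hCd : (C * Matrix.diagonal d).PosDef) : C.PosDef := by
  have heq : ∀ {i j}, C i j ≠ 0 → d i = d j := fun {i j} hij => by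
    have h := hCd.isHermitian.apply i j
    simp only [Matrix.mul_diagonal, star_trivial, hsymm j i] at h
    exact mul_left_cancel₀ hij h
  let part (x : V → ℤ) (v : ℤ) : V → ℤ := fun i => if d i = v then x i else 0
  have hpart : ∀ x v, v * (part x v ⬝ᵥ C *ᵥ part x v) =
      part x v ⬝ᵥ (C * Matrix.diagonal d) *ᵥ part x v := fun x v => by
    simp only [dotProduct, Matrix.mulVec, Matrix.mul_diagonal, Finset.mul_sum, part]
    refine Finset.sum_congr rfl fun i _ => Finset.sum_congr rfl fun j _ => ?_
    obtain rfl | hj := eq_or_ne (d j) v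
    · ring
    · rw [if_neg hj]
      ring
  have hsum : ∀ x, ∑ v ∈ Finset.univ.image d, part x v ⬝ᵥ C *ᵥ part x v = x ⬝ᵥ C *ᵥ x := fun x => by
    simp only [dotProduct, Matrix.mulVec, Finset.mul_sum, part]
    rw [Finset.sum_comm]
    refine Finset.sum_congr rfl fun i _ => ?_
    rw [Finset.sum_comm]
    refine Finset.sum_congr rfl fun j _ => ?_
    rw [Finset.sum_eq_single_of_mem (d i) (by simp) fun v _ hv => by rw [if_neg hv.symm, zero_mul],
      if_pos rfl]
    by_cases hij : C i j = 0
    · simp [hij]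
    · rw [if_pos (heq hij).symm]
  refine .of_dotProduct_mulVec_pos (Matrix.IsHermitian.ext fun i j => hsymm j i) fun x hx => ?_
  obtain ⟨i, hi⟩ := Function.ne_iff.1 hx
  have hpos : ∀ v, 0 < v → part x v ≠ 0 → 0 < part x v ⬝ᵥ C *ᵥ part x v := fun v hv hne =>
    pos_of_mul_pos_right (a := v) (by
      rw [hpart]
      exact hCd.dotProduct_mulVec_pos hne) hv.le
  rw [star_trivial, ← hsum]
  refine Finset.sum_pos' (fun v hv => ?_) ⟨d i, by simp, hpos _ (hd i) fun h => hi ?_⟩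
  · obtain ⟨j, -, rfl⟩ := Finset.mem_image.1 hv
    obtain h | h := eq_or_ne (part x (d j)) 0
    · simp [h]
    · exact (hpos _ (hd j) h).le
  · simpa [part] using congrFun h i

section RootLattice

variable {ι M N : Type*} [AddCommGroup M] [Module ℂ M] [AddCommGroup N] [Module ℂ N]
  {P : RootPairing ι ℂ M N} (b : P.Base)

/-- The embedding of the root lattice, with basis the simple roots, into `M`. -/
def latticeMap : (b.support → ℤ) →ₗ[ℤ] M :=
  Fintype.linearCombination ℤ fun i : b.support => P.root i

theorem latticeMap_apply (x : b.support → ℤ) : latticeMap b x = ∑ i, x i • P.root i := rfl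

theorem latticeMap_simple (i : b.support) : latticeMap b (simple i) = P.root i := by
  simp [latticeMap_apply, simple_apply]

theorem gammaRoot_eq_latticeMap (Q : Digraph b.support) (i : b.support) :
    gammaRoot b Q i = latticeMap b (gammaVec Q i) := by
  simp [gammaRoot, gammaVec, latticeMap_simple]

section Crystallographic

variable [P.IsCrystallographic]

theorem isPosSimplyLaced_cartanMatrix [Finite ι] [P.IsRootSystem] [P.IsReduced]
    (hSL : b.cartanMatrix.IsSimplyLaced) : IsPosSimplyLaced b.cartanMatrix := by
  obtain ⟨d, hd, hCd⟩ := b.exists_cartanMatrix_mul_diagaonal_posDef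
  refine ⟨b.cartanMatrix_apply_same, hSL, posDef_of_posDef_mul_diagonal (fun i j => ?_) hd hCd⟩
  obtain rfl | hij := eq_or_ne i j
  · rfl
  · have hzero := b.cartanMatrix_apply_eq_zero_iff_symm (i := i) (j := j)
    rcases hSL hij with h | h <;> rcases hSL hij.symm with h' | h' <;> simp_all

variable {b} in
theorem reflection_latticeMap (hC : IsPosSimplyLaced b.cartanMatrix) (i : b.support)
    (x : b.support → ℤ) : P.reflection i (latticeMap b x) = latticeMap b (hC.refl i x) := by
  have hsimple : ∀ k : b.support, P.reflection i (latticeMap b (simple k)) =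
      latticeMap b (hC.refl i (simple k)) := fun k => by
    rw [hC.refl_apply, latticeForm_simple, map_sub, map_smul, latticeMap_simple, latticeMap_simple]
    exact P.reflection_apply_root' ℤ
  rw [← sum_smul_simple x]
  simp only [map_sum, map_smul, map_zsmul, hsimple]

theorem coxeterElement_latticeMap (hC : IsPosSimplyLaced b.cartanMatrix) (Q : Digraph b.support)
    (x : b.support → ℤ) :
    coxeterElement b Q (latticeMap b x) = latticeMap b (hC.wordProd (coxeterWord Q) x) := by
  have hcoe : ∀ l : List b.support, (do let a ← l; pure (a : ι)) = l.map (↑) :=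
    fun l => List.flatMap_pure_eq_map _ l
  rw [coxeterElement, hcoe, IsPosSimplyLaced.wordProd]
  induction coxeterWord Q with
  | nil => simp
  | cons i l ih =>
    simp only [List.map_cons, List.prod_cons, LinearEquiv.mul_apply, ih, reflection_latticeMap hC]

theorem betaSeq_eq_or_eq_neg (hC : IsPosSimplyLaced b.cartanMatrix) (Q : Digraph b.support)
    (j : b.support) (m : ℕ) :
    betaSeq b Q j m = latticeMap b ((hC.wordProd (coxeterWord Q) ^ m) (gammaVec Q j)) ∨
      betaSeq b Q j m = -latticeMap b ((hC.wordProd (coxeterWord Q) ^ m) (gammaVec Q j)) := by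
  induction m with
  | zero => exact Or.inl (gammaRoot_eq_latticeMap b Q j)
  | succ m ih =>
    rw [betaSeq, pow_succ', LinearEquiv.mul_apply, ← coxeterElement_latticeMap]
    split_ifs <;> rcases ih with h | h <;> simp [h]

theorem beta_eq_or_eq_neg (hC : IsPosSimplyLaced b.cartanMatrix) (Q : Digraph b.support)
    {ξ : b.support → ℤ} (z : Below ξ) :
    beta b Q z = latticeMap b (signedRoot Q ξ (hC.wordProd (coxeterWord Q)) z.1.1 z.1.2) ∨
      beta b Q z = -latticeMap b (signedRoot Q ξ (hC.wordProd (coxeterWord Q)) z.1.1 z.1.2) := by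
  obtain ⟨m, hm⟩ := z.2
  rw [signedRoot_of_eq Q hm, beta, show ((ξ z.1.1 - z.1.2) / 2).toNat = m by omega]
  exact betaSeq_eq_or_eq_neg b hC Q z.1.1 m

variable {b} in
theorem exists_latticeMap_eq_root [Finite ι] [P.IsRootSystem] [P.IsReduced]
    (hC : IsPosSimplyLaced b.cartanMatrix) {k : ι} (hk : b.IsPos k) :
    ∃ y : b.support → ℤ, latticeForm b.cartanMatrix y y = 2 ∧ 0 ≤ y ∧
      latticeMap b y = P.root k := by
  obtain ⟨y, hy, hyk⟩ : ∃ y : b.support → ℤ, latticeForm b.cartanMatrix y y = 2 ∧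
      latticeMap b y = P.root k := by
    refine hk.induction_on_reflect (p := fun k => ∃ y : b.support → ℤ,
      latticeForm b.cartanMatrix y y = 2 ∧ latticeMap b y = P.root k) (fun i hi => ?_) ?_
    · exact ⟨simple ⟨i, hi⟩, by rw [latticeForm_simple, hC.diag], latticeMap_simple b ⟨i, hi⟩⟩
    · rintro i j ⟨y, hy, hyi⟩ hj
      refine ⟨hC.refl ⟨j, hj⟩ y, by rw [hC.form_refl, hy], ?_⟩
      rw [← reflection_latticeMap, hyi, P.root_reflectionPerm]
  refine ⟨y, hy, (hC.nonneg_or_nonpos hy).resolve_right fun hneg => ?_, hyk⟩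
  have hheight := b.height_eq_sum (i := k)
    (f := fun j => if hj : j ∈ b.support then y ⟨j, hj⟩ else 0) (by
      rw [← hyk, latticeMap_apply, ← Finset.sum_coe_sort b.support]
      simp)
  have hsum : b.height k = ∑ j, y j := by
    rw [hheight, ← Finset.sum_coe_sort b.support]
    simp
  have hle : ∑ j, y j ≤ 0 := Finset.sum_nonpos fun j _ => hneg j
  exact (hsum.trans_le hle).not_gt hk

end Crystallographic

end RootLattice

section Below

variable {V : Type*} {ξ : V → ℤ}

theorem exists_eq_sub_two_mul_iff {m n : ℤ} : (∃ k : ℕ, m = n - 2 * k) ↔ m ≤ n ∧ 2 ∣ n - m :=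
  ⟨by rintro ⟨k, rfl⟩; omega, fun h => ⟨((n - m) / 2).toNat, by omega⟩⟩

theorem finsum_below_eq_sum [Fintype V] {G : V → ℤ → ℤ} {p T : ℤ} (hT : ∀ k, ξ k < T)
    (hp : ∀ j s, s < p → G j s = 0) (hG : ∀ j s, ¬ (s ≤ ξ j ∧ 2 ∣ ξ j - s) → G j s = 0) :
    ∑ᶠ y : Below ξ, G y.1.1 y.1.2 = ∑ s ∈ Finset.Ioc (p - 1) T, ∑ j, G j s := by
  have hsupp : (Function.support fun z : V × ℤ => G z.1 z.2) ⊆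
      {z | ∃ k : ℕ, z.2 = ξ z.1 - 2 * k} := fun z hz =>
    exists_eq_sub_two_mul_iff.2 (not_not.1 fun h => hz (hG _ _ h))
  have hfin : (Function.support fun z : V × ℤ => G z.1 z.2) ⊆
      ↑((Finset.univ : Finset V) ×ˢ Finset.Ioc (p - 1) T) := fun z hz => by
    have hlow : p ≤ z.2 := not_lt.1 fun h => hz (hp _ _ h)
    have hup := (exists_eq_sub_two_mul_iff.1 (hsupp hz)).1
    have := hT z.1
    simp only [Finset.coe_product, Finset.coe_univ, Finset.coe_Ioc, Set.mem_prod, Set.mem_univ,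
      Set.mem_Ioc, true_and]
    omega
  calc ∑ᶠ y : Below ξ, G y.1.1 y.1.2
      = ∑ᶠ z ∈ {z : V × ℤ | ∃ k : ℕ, z.2 = ξ z.1 - 2 * k}, G z.1 z.2 :=
        finsum_set_coe_eq_finsum_mem (f := fun z : V × ℤ => G z.1 z.2) _
    _ = ∑ᶠ z : V × ℤ, G z.1 z.2 := by rw [finsum_mem_def, Set.indicator_eq_self.2 hsupp]
    _ = ∑ s ∈ Finset.Ioc (p - 1) T, ∑ j, G j s := by
        rw [finsum_eq_sum_of_support_subset _ hfin, Finset.sum_product_right]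

end Below

section LinForm

variable {ι M N : Type*} [AddCommGroup M] [Module ℂ M] [AddCommGroup N] [Module ℂ N]
  {P : RootPairing ι ℂ M N} [P.IsRootSystem] (b : P.Base)

theorem repr_latticeMap (x : b.support → ℤ) (i : b.support) :
    b.toWeightBasis.repr (latticeMap b x) i = x i := by
  simp [latticeMap_apply, Finsupp.single_apply]

theorem latticeMap_ne_zero {x : b.support → ℤ} (hx : x ≠ 0) : latticeMap b x ≠ 0 := by
  obtain ⟨i, hi⟩ := Function.ne_iff.1 hx
  intro h
  have hrepr := repr_latticeMap b x i
  rw [h, map_zero, Finsupp.zero_apply] at hrepr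
  exact hi (Int.cast_eq_zero.1 hrepr.symm)

theorem coeff_linForm (v : M) (i : b.support) :
    (linForm b v).coeff (Finsupp.single i 1) = b.toWeightBasis.repr v i := by
  simp [linForm, MvPolynomial.coeff_sum, MvPolynomial.coeff_C_mul, MvPolynomial.coeff_X,
    Finsupp.single_left_inj]

theorem linForm_neg (v : M) : linForm b (-v) = -linForm b v := by
  simp [linForm]

theorem totalDegree_linForm {v : M} (hv : v ≠ 0) : (linForm b v).totalDegree = 1 := by
  obtain ⟨i, hi⟩ := Finsupp.ne_iff.1 (b.toWeightBasis.repr.map_ne_zero_iff.2 hv)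
  refine le_antisymm (MvPolynomial.totalDegree_finsetSum_le fun j _ => ?_) ?_
  · exact (MvPolynomial.totalDegree_mul _ _).trans (by simp)
  · refine le_of_eq_of_le (by simp) (MvPolynomial.le_totalDegree (s := Finsupp.single i 1) ?_)
    rwa [MvPolynomial.mem_support_iff, coeff_linForm]

theorem prime_linForm {v : M} (hv : v ≠ 0) : Prime (linForm b v) := by
  obtain ⟨i, hi⟩ := Finsupp.ne_iff.1 (b.toWeightBasis.repr.map_ne_zero_iff.2 hv)
  refine (MvPolynomial.irreducible_of_totalDegree_eq_one (totalDegree_linForm b hv)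
    fun c hc => ?_).prime
  have hdvd := hc (Finsupp.single i 1)
  rw [coeff_linForm] at hdvd
  exact isUnit_of_dvd_unit hdvd (Ne.isUnit hi)

theorem exists_smul_eq_of_linForm_dvd {v w : M} (hv : v ≠ 0) (hw : w ≠ 0)
    (h : linForm b v ∣ linForm b w) : ∃ c : ℂ, c • v = w := by
  obtain ⟨u, hu⟩ := (prime_linForm b hv).associated_of_dvd (prime_linForm b hw) h
  obtain ⟨c, -, hc⟩ := MvPolynomial.isUnit_iff_eq_C_of_isReduced.1 u.isUnit
  refine ⟨c, b.toWeightBasis.repr.injective (Finsupp.ext fun i => ?_)⟩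
  rw [map_smul, Finsupp.smul_apply, smul_eq_mul, ← coeff_linForm, ← coeff_linForm, ← hu, hc,
    mul_comm (linForm b v), MvPolynomial.coeff_C_mul]

theorem multiplicity_linForm_latticeMap [P.IsCrystallographic] {x y : b.support → ℤ}
    (hx : latticeForm b.cartanMatrix x x = 2) (hy : latticeForm b.cartanMatrix y y = 2) :
    multiplicity (linForm b (latticeMap b y)) (linForm b (latticeMap b x)) =
      if x = y ∨ x = -y then 1 else 0 := by
  have hx0 : x ≠ 0 := by rintro rfl; simp at hx
  have hy0 : y ≠ 0 := by rintro rfl; simp at hy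
  split_ifs with h
  · have hassoc : Associated (linForm b (latticeMap b x)) (linForm b (latticeMap b y)) := by
      rcases h with rfl | rfl
      · exact .refl _
      · rw [map_neg, linForm_neg]
        exact (Associated.refl _).neg_left
    rw [multiplicity_eq_of_associated_right hassoc, multiplicity_self]
  · refine multiplicity_eq_zero.2 fun hdvd => h ?_
    obtain ⟨c, hc⟩ := exists_smul_eq_of_linForm_dvd b (latticeMap_ne_zero b hy0)
      (latticeMap_ne_zero b hx0) hdvd
    have hcoord : ∀ j, c * y j = x j := fun j => by
      rw [← repr_latticeMap, ← repr_latticeMap, ← hc, map_smul, Finsupp.smul_apply, smul_eq_mul]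
    obtain ⟨i, hi⟩ := Function.ne_iff.1 hy0
    refine eq_or_eq_neg_of_smul_eq_smul hx hy hi (n := x i) (funext fun j => ?_)
    have hcross : (y i : ℂ) * x j = x i * y j := by
      rw [← hcoord i, ← hcoord j]
      ring
    exact_mod_cast hcross

theorem rootMult_eq_primeOrder {v : M} (hv : v ≠ 0) (f : (RootField b)ˣ) :
    rootMult b v f = Multiplicative.toAdd (primeOrder (prime_linForm b hv) f) :=
  rfl

variable [P.IsCrystallographic]

theorem rootMult_dTilde_yVar {v : M} (hv : v ≠ 0) (Q : Digraph b.support) {ξ : b.support → ℤ}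
    (x : Below ξ) :
    rootMult b v (dTilde b Q ξ (yVar x)) =
      ∑ᶠ y : Below ξ, (cTilde b.cartanMatrix x.1.1 y.1.1 (y.1.2 - x.1.2 - 1) -
        cTilde b.cartanMatrix x.1.1 y.1.1 (y.1.2 - x.1.2 + 1)) * rootMult b v (betaUnit b Q y) := by
  have hfin := finite_mulSupport_dTildeValue b Q ξ x
  rw [dTilde_yVar, rootMult_eq_primeOrder b hv, dTildeValue,
    finprod_eq_prod_of_mulSupport_subset _ hfin.coe_toFinset.ge, map_prod, toAdd_prod,
    finsum_eq_sum_of_support_subset (s := hfin.toFinset)]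
  · simp only [map_zpow, toAdd_zpow, smul_eq_mul, rootMult_eq_primeOrder b hv]
  · intro y hy
    rw [hfin.coe_toFinset]
    intro hone
    refine hy ?_
    simpa only [map_zpow, map_one, toAdd_zpow, toAdd_one, smul_eq_mul,
      rootMult_eq_primeOrder b hv] using
      congrArg (fun f => Multiplicative.toAdd (primeOrder (prime_linForm b hv) f)) hone

variable {Q : Digraph b.support} {ξ : b.support → ℤ} {r : b.support → ℤ → b.support → ℤ}
  {y : b.support → ℤ}

theorem rootMult_betaUnit (hC : IsPosSimplyLaced b.cartanMatrix)
    (hr : IsMeshFamily b.cartanMatrix ξ r) (hy : latticeForm b.cartanMatrix y y = 2) {z : Below ξ}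
    (hz : beta b Q z = latticeMap b (r z.1.1 z.1.2) ∨
      beta b Q z = -latticeMap b (r z.1.1 z.1.2)) :
    rootMult b (latticeMap b y) (betaUnit b Q z) =
      if r z.1.1 z.1.2 = y ∨ r z.1.1 z.1.2 = -y then 1 else 0 := by
  have hy0 : y ≠ 0 := by rintro rfl; simp at hy
  have hassoc : Associated (linForm b (beta b Q z))
      (linForm b (latticeMap b (r z.1.1 z.1.2))) := by
    rcases hz with h | h <;> rw [h]
    rw [linForm_neg]
    exact (Associated.refl _).neg_left
  rw [rootMult_eq_primeOrder b (latticeMap_ne_zero b hy0),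
    primeOrder_of_eq_algebraMap _ (linForm_ne_zero b (beta_ne_zero b Q z)) rfl, toAdd_ofAdd,
    multiplicity_eq_of_associated_right hassoc,
    multiplicity_linForm_latticeMap b (hr.form_self hC (exists_eq_sub_two_mul_iff.1 z.2)) hy]
  push_cast
  rfl

theorem rootMult_dTilde_yVar_eq_sum (hC : IsPosSimplyLaced b.cartanMatrix)
    (hr : IsMeshFamily b.cartanMatrix ξ r) (hy : latticeForm b.cartanMatrix y y = 2)
    (hbeta : ∀ z : Below ξ, beta b Q z = latticeMap b (r z.1.1 z.1.2) ∨
      beta b Q z = -latticeMap b (r z.1.1 z.1.2)) {T : ℤ} (hT : ∀ k, ξ k < T) (x : Below ξ) :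
    rootMult b (latticeMap b y) (dTilde b Q ξ (yVar x)) =
      ∑ s ∈ Finset.Ioc (x.1.2 - 1) T, ∑ j, if r j s = y ∨ r j s = -y then
        cTilde b.cartanMatrix x.1.1 j (s - x.1.2 - 1) -
          cTilde b.cartanMatrix x.1.1 j (s - x.1.2 + 1) else 0 := by
  have hy0 : y ≠ 0 := by rintro rfl; simp at hy
  simp only [rootMult_dTilde_yVar b (latticeMap_ne_zero b hy0),
    rootMult_betaUnit b hC hr hy (hbeta _), mul_ite, mul_one, mul_zero]
  refine finsum_below_eq_sum (G := fun j s => if r j s = y ∨ r j s = -y then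
    cTilde b.cartanMatrix x.1.1 j (s - x.1.2 - 1) - cTilde b.cartanMatrix x.1.1 j (s - x.1.2 + 1)
    else 0) hT (fun j s hs => ?_) fun j s hs => ?_
  · have hzero := (isInverseRow_cTilde hC x.1.1).eq_zero
    simp only [hzero j (show s - x.1.2 - 1 ≤ 0 by omega),
      hzero j (show s - x.1.2 + 1 ≤ 0 by omega), sub_zero, ite_self]
  · simp [hr.eq_zero hs, eq_comm, hy0]

end LinForm

end

end DynkinQuiver

theorem proposition6p9_general {ι M N : Type*} [Finite ι] [AddCommGroup M] [Module ℂ M]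
    [AddCommGroup N] [Module ℂ N] {P : RootPairing ι ℂ M N} [P.IsRootSystem]
    [P.IsCrystallographic] [P.IsReduced] (b : P.Base) (hSL : b.cartanMatrix.IsSimplyLaced)
    (Q : Digraph b.support) (hQ : DynkinQuiver.IsOrientation b Q) (ξ : b.support → ℤ)
    (hξ : DynkinQuiver.IsHeightFunction Q ξ) (x : DynkinQuiver.Below ξ) {k : ι}
    (hk : b.IsPos k) :
    |DynkinQuiver.rootMult b (P.root k)
      (DynkinQuiver.dTilde b Q ξ (DynkinQuiver.yVar x))| ≤ 1 := by
  have hC := DynkinQuiver.isPosSimplyLaced_cartanMatrix b hSL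
  have hQC : DynkinQuiver.IsOrientationOf Q b.cartanMatrix := ⟨hQ.1, hQ.2⟩
  have hr := hQC.isMeshFamily_signedRoot hC hξ
    ((DynkinQuiver.coxeterWord_spec Q ξ hξ).wordProd_apply hC hQC hξ)
  obtain ⟨y, hy, hpos, hyk⟩ := DynkinQuiver.exists_latticeMap_eq_root hC hk
  obtain ⟨B, hB⟩ := (Set.finite_range ξ).bddAbove
  have hT : ∀ j, ξ j < B + 1 := fun j => Int.lt_add_one_of_le (hB ⟨j, rfl⟩)
  rw [← hyk, DynkinQuiver.rootMult_dTilde_yVar_eq_sum b hC hr hy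
    (DynkinQuiver.beta_eq_or_eq_neg b hC Q) hT]
  exact hr.abs_sum_exponent_le hC (DynkinQuiver.isInverseRow_cTilde hC x.1.1)
    (DynkinQuiver.exists_eq_sub_two_mul_iff.1 x.2) hT hy hpos

theorem proposition6p9 {L : Type*} [LieRing L] [LieAlgebra ℂ L] [FiniteDimensional ℂ L]
    [LieAlgebra.IsSimple ℂ L] (H : LieSubalgebra ℂ L) [H.IsCartanSubalgebra]
    (b : (LieAlgebra.IsKilling.rootSystem H).Base) (hC : b.cartanMatrix.IsSimplyLaced)
    (Q : Digraph b.support) (hQ : DynkinQuiver.IsOrientation b Q)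
    (ξ : b.support → ℤ) (hξ : DynkinQuiver.IsHeightFunction Q ξ)
    (x : DynkinQuiver.Below ξ) (β : H.root) (hβ : b.IsPos β) :
    |DynkinQuiver.rootMult b ((LieAlgebra.IsKilling.rootSystem H).root β)
      (DynkinQuiver.dTilde b Q ξ (DynkinQuiver.yVar x))| ≤ 1 :=
  proposition6p9_general b hC Q hQ ξ hξ x hβ
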